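/- Theorem 3.2. Let $\mathfrak g$ be a finite-dimensional simple complex Lie algebra with a non-degenerate symmetric invariant bilinear form $(\ ,\ )$, and let $A$ be a finitely generated commutative associative unital $\mathbb C$-algebra. Let $\tilde{\mathfrak g}=\mathfrak g\otimes\mathbb C[t,t^{-1}]\oplus\mathbb CK$, and let $\tau=\tilde{\mathfrak g}\oplus\bigoplus_{n\in\mathbb Z}\mathbb CL_n$ be the Lie algebra in which $K$ is central and, writing $x(n)=x\otimes t^n$, $$[x(n),y(m)]=[x,y](n+m)+n\,\delta_{n+m,0}(x,y)K,\qquad [L_n,x(m)]=m\,x(n+m),$$ $$[L_n,L_m]=(m-n)L_{n+m}+\delta_{n+m,0}\tfrac{n^3-n}{12}K .$$ Let $\tau(A)=\tau\otimes A$ with bracket $[u\otimes a,v\otimes b]=[u,v]\otimes ab$; write $u(a)=u\otimes a$, and regard $\tau\subset\tau(A)$ through $u\mapsto u(1)$. Let $\mathfrak h$ be a Cartan subalgebra of $\mathfrak g$, $\overset{\circ}{\Delta}$ the root system, and fix simple roots $\alpha_1,\dots,\alpha_\ell$, with positive roots $\overset{\circ}{\Delta}{}^+$ and highest root $\beta$.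 Put $d=L_0$ and $\bar{\mathfrak h}=\mathfrak h\oplus\mathbb CK\oplus\mathbb Cd$, and extend $(\ ,\ )$ from $\mathfrak h$ to $\bar{\mathfrak h}$ by $(K,d)=1$, $(K,K)=(d,d)=(K,\mathfrak h)=(d,\mathfrak h)=0$. Let $\gamma:\bar{\mathfrak h}\to\bar{\mathfrak h}^*$, $\gamma(s)(s')=(s,s')$, be the induced isomorphism, and transport the form to $\bar{\mathfrak h}^*$ through $\gamma$. Extend each $\alpha\in\mathfrak h^*$ to $\bar{\mathfrak h}$ by $\alpha(K)=\alpha(d)=0$; let $\delta\in\bar{\mathfrak h}^*$ be given by $\delta(\mathfrak h)=\delta(K)=0$, $\delta(d)=1$, and put $\alpha_0=-\beta+\delta$. The affine roots are $\alpha+n\delta$ ($\alpha\in\overset{\circ}{\Delta}$, $n\in\mathbb Z$) and $n\delta$ ($n\ne0$); such a root is positive if it has the form $\sum_{i=0}^{\ell}c_i\alpha_i$ with integers $c_i\ge0$, and its height is then $\sum_i c_i$. For $\mu\in\bar{\mathfrak h}^*$ let $\tau_\mu=\{u\in\tau:[s,u]=\mu(s)u\ \ \forall s\in\bar{\mathfrak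 h}\}$. A $\tau(A)$-module $V$ is in category $\mathcal O$ if it is the direct sum of its weight spaces for $\bar{\mathfrak h}$, these are all finite-dimensional, and for all $v\in V$, $a\in A$ there is $N$ such that $u(a)v=0$ whenever $u\in\tau_\mu$ for a positive affine root $\mu$ of height at least $N$. Choose $\rho\in\bar{\mathfrak h}^*$ with $(\rho,\alpha_i)=\frac12(\alpha_i,\alpha_i)$ for $0\le i\le\ell$, bases $\{h_i\}$, $\{h^i\}$ of $\mathfrak h$ with $(h_i,h^j)=\delta_{ij}$, and root vectors $x_\alpha\in\mathfrak g_\alpha$ ($\alpha\in\overset{\circ}{\Delta}$) with $(x_\alpha,x_{-\alpha})=1$. For $a,b\in A$ set $$\Omega^1_{a,b}=\sum_{\alpha\in\overset{\circ}{\Delta}}\sum_{n>0}x_{-\alpha}(-n)(a)\,x_\alpha(n)(b),\quad \Omega^2_{a,b}=\sum_i\sum_{n>0}h_i(-n)(a)\,h^i(n)(b),\quad \Omega^3_{a,b}=\sum_{\alpha\in\overset{\circ}{\Delta}{}^+}x_{-\alpha}(a)\,x_\alpha(b),$$ $$\Omega(a,b)=2\gamma^{-1}(\rho)(ab)+\sum_ih_i(a)h^i(b)+K(a)d(b)+K(b)d(a)+\Omega^1_{a,b}+\Omega^1_{b,a}+\Omega^2_{a,b}+\Omega^2_{b,a}+\Omega^3_{a,b}+\Omega^3_{b,a},$$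 and $T_0(a,b)=\Omega(a,b)$, $T_j(a,b)=-\frac1j[L_j,\Omega(a,b)]$ for $0\ne j\in\mathbb Z$. Then on every module $V$ in category $\mathcal O$, for all $a,b\in A$, the sums over $n>0$ above have only finitely many non-zero terms when applied to any vector of $V$, and for every $j\in\mathbb Z$ the operator $T_j(a,b)$ is an affine central operator: it is a well-defined linear operator on $V$ which commutes with the action of $\tilde{\mathfrak g}$. -/

import Mathlib

open scoped TensorProduct

noncomputable section

namespace LoopAffineVirasoro

/-- A non-degenerate symmetric invariant bilinear form on a complex Lie algebra. -/
structure InvariantForm (g : Type*) [LieRing g] [LieAlgebra ℂ g] where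
  form : LinearMap.BilinForm ℂ g
  symm : ∀ x y : g, form x y = form y x
  invariant : ∀ x y z : g, form ⁅x, y⁆ z = form x ⁅y, z⁆
  nondegenerate : ∀ x : g, (∀ y : g, form x y = 0) → x = 0

/-! ### The affine-Virasoro algebra -/

section Tau

variable {g : Type*} [LieRing g] [LieAlgebra ℂ g]

/-- The vector space underlying the affine-Virasoro algebra `τ`, namely
`g ⊗ ℂ[t, t⁻¹] ⊕ (⨁ₙ ℂ Lₙ) ⊕ ℂ K`. The first factor consists of the finite sums `∑ Xₙ ⊗ tⁿ`, the
second of the finite sums `∑ cₙ Lₙ`. The central elements of the affine algebra and of the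
Virasoro algebra are identified, so that there is a single `K`. -/
def Tau (_B : InvariantForm g) : Type _ := (ℤ →₀ g) × (ℤ →₀ ℂ) × ℂ

namespace Tau

variable (B : InvariantForm g)

instance : AddCommGroup (Tau B) := inferInstanceAs (AddCommGroup ((ℤ →₀ g) × (ℤ →₀ ℂ) × ℂ))
instance : Module ℂ (Tau B) := inferInstanceAs (Module ℂ ((ℤ →₀ g) × (ℤ →₀ ℂ) × ℂ))

/-- `x ↦ x ⊗ tⁿ`. -/
def X (n : ℤ) : g →ₗ[ℂ] Tau B := LinearMap.inl ℂ (ℤ →₀ g) ((ℤ →₀ ℂ) × ℂ) ∘ₗ Finsupp.lsingle n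

/-- The element `Lₙ`. -/
def L (n : ℤ) : Tau B := ((0, Finsupp.single n 1, 0) : (ℤ →₀ g) × (ℤ →₀ ℂ) × ℂ)

/-- The central element `K`. -/
def K : Tau B := ((0, 0, 1) : (ℤ →₀ g) × (ℤ →₀ ℂ) × ℂ)

/-- The linear map on `τ` with prescribed values on the elements `x ⊗ tⁿ`, `Lₙ` and `K`. -/
def lift {M : Type*} [AddCommGroup M] [Module ℂ M] (f : ℤ → g →ₗ[ℂ] M) (l : ℤ → M) (k : M) :
    Tau B →ₗ[ℂ] M :=
  LinearMap.coprod (Finsupp.lsum ℂ f)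
    (LinearMap.coprod (Finsupp.lsum ℂ fun n => LinearMap.toSpanSingleton ℂ M (l n))
      (LinearMap.toSpanSingleton ℂ M k))

variable {B} in
lemma lift_X {M : Type*} [AddCommGroup M] [Module ℂ M] (f : ℤ → g →ₗ[ℂ] M) (l : ℤ → M) (k : M)
    (n : ℤ) (x : g) : lift B f l k (X B n x) = f n x := by
  change Finsupp.lsum ℂ f (Finsupp.single n x) +
    (Finsupp.lsum ℂ (fun n => LinearMap.toSpanSingleton ℂ M (l n)) 0 + (0 : ℂ) • k) = f n x
  simp

variable {B} in
lemma lift_L {M : Type*} [AddCommGroup M] [Module ℂ M] (f : ℤ → g →ₗ[ℂ] M) (l : ℤ → M) (k : M)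
    (n : ℤ) : lift B f l k (L B n) = l n := by
  change Finsupp.lsum ℂ f 0 + (Finsupp.lsum ℂ (fun n => LinearMap.toSpanSingleton ℂ M (l n))
    (Finsupp.single n 1) + (0 : ℂ) • k) = l n
  simp

variable {B} in
lemma lift_K {M : Type*} [AddCommGroup M] [Module ℂ M] (f : ℤ → g →ₗ[ℂ] M) (l : ℤ → M) (k : M) :
    lift B f l k (K B) = k := by
  change Finsupp.lsum ℂ f 0 + (Finsupp.lsum ℂ (fun n => LinearMap.toSpanSingleton ℂ M (l n)) 0 +
    (1 : ℂ) • k) = k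
  simp

/-- The bracket of `τ`, as a bilinear map:
* `[x ⊗ tⁿ, y ⊗ tᵐ] = [x, y] ⊗ tⁿ⁺ᵐ + n δ_{n+m,0} (x, y) K`,
* `[Lₙ, x ⊗ tᵐ] = m x ⊗ tᵐ⁺ⁿ = -[x ⊗ tᵐ, Lₙ]`,
* `[Lₙ, Lₘ] = (m - n) Lₙ₊ₘ + δ_{n+m,0} (n³ - n)/12 K`,
* `K` is central. -/
def br : Tau B →ₗ[ℂ] Tau B →ₗ[ℂ] Tau B :=
  lift B
    (fun n => LinearMap.flip (lift B
      (fun m => LinearMap.flip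
        ((LieModule.toEnd ℂ g g : g →ₗ[ℂ] g →ₗ[ℂ] g).compr₂ (X B (n + m)) +
          B.form.compr₂ (LinearMap.toSpanSingleton ℂ (Tau B)
            ((if n + m = 0 then (n : ℂ) else 0) • K B))))
      (fun m => -((n : ℂ) • X B (n + m)))
      0))
    (fun n => lift B
      (fun m => (m : ℂ) • X B (m + n))
      (fun m => ((m : ℂ) - n) • L B (n + m) +
        (if n + m = 0 then ((n : ℂ) ^ 3 - n) / 12 else 0) • K B)
      0)
    0

instance : Bracket (Tau B) (Tau B) := ⟨fun u v => br B u v⟩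

lemma lie_def (u v : Tau B) : ⁅u, v⁆ = br B u v := rfl

lemma X_lie_X (n m : ℤ) (x y : g) : ⁅X B n x, X B m y⁆ =
    X B (n + m) ⁅x, y⁆ + ((if n + m = 0 then (n : ℂ) else 0) * B.form x y) • K B := by
  simp [lie_def, br, lift_X, smul_smul, mul_comm]

lemma L_lie_X (n m : ℤ) (x : g) : ⁅L B n, X B m x⁆ = (m : ℂ) • X B (m + n) x := by
  simp [lie_def, br, lift_X, lift_L]

lemma X_lie_L (n m : ℤ) (x : g) : ⁅X B n x, L B m⁆ = -((n : ℂ) • X B (n + m) x) := by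
  simp [lie_def, br, lift_X, lift_L]

lemma L_lie_L (n m : ℤ) : ⁅L B n, L B m⁆ = ((m : ℂ) - n) • L B (n + m) +
    (if n + m = 0 then ((n : ℂ) ^ 3 - n) / 12 else 0) • K B := by
  simp [lie_def, br, lift_L]

lemma K_lie (u : Tau B) : ⁅K B, u⁆ = 0 := by
  simp [lie_def, br, lift_K]

variable {B} in
/-- Two linear maps on `τ` agree if they agree on the elements `x ⊗ tⁿ`, `Lₙ` and `K`. -/
lemma hom_ext {M : Type*} [AddCommGroup M] [Module ℂ M] {f h : Tau B →ₗ[ℂ] M}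
    (hX : ∀ n x, f (X B n x) = h (X B n x)) (hL : ∀ n, f (L B n) = h (L B n))
    (hK : f (K B) = h (K B)) : f = h := by
  refine LinearMap.prod_ext (R := ℂ) (M := ℤ →₀ g) (M₂ := (ℤ →₀ ℂ) × ℂ) ?_ ?_
  · ext n x
    exact hX n x
  · refine LinearMap.prod_ext ?_ ?_
    · ext n
      exact hL n
    · ext
      exact hK

variable {B} in
/-- An additive and homogeneous property holds on `τ` if it holds on `x ⊗ tⁿ`, `Lₙ` and `K`. -/
lemma ind {P : Tau B → Prop} (hadd : ∀ u v, P u → P v → P (u + v))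
    (hsmul : ∀ (c : ℂ) u, P u → P (c • u)) (hX : ∀ n x, P (X B n x)) (hL : ∀ n, P (L B n))
    (hK : P (K B)) (u : Tau B) : P u := by
  let S : Submodule ℂ (Tau B) :=
    { carrier := {u | P u}
      add_mem' := fun {u v} hu hv => hadd u v hu hv
      zero_mem' := by simpa using hsmul 0 _ hK
      smul_mem' := fun c u hu => hsmul c u hu }
  have hS : S.mkQ = 0 := by
    refine hom_ext (fun n x => ?_) (fun n => ?_) ?_ <;>
      simp only [LinearMap.zero_apply, Submodule.mkQ_apply, Submodule.Quotient.mk_eq_zero]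
    · exact hX n x
    · exact hL n
    · exact hK
  have : S.mkQ u = 0 := by rw [hS]; rfl
  exact (Submodule.Quotient.mk_eq_zero S).1 this

lemma lie_K (u : Tau B) : ⁅u, K B⁆ = 0 := by
  have : (br B).flip (K B) = 0 := by
    refine hom_ext (fun n x => ?_) (fun n => ?_) ?_ <;> simp [br, lift_X, lift_L, lift_K]
  exact LinearMap.congr_fun this u

lemma skew (u v : Tau B) : ⁅u, v⁆ = -⁅v, u⁆ := by
  have : br B = -(br B).flip := by
    refine hom_ext (fun n x => ?_) (fun n => ?_) ?_
    · refine hom_ext (fun m y => ?_) (fun m => ?_) ?_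
      · change ⁅X B n x, X B m y⁆ = -⁅X B m y, X B n x⁆
        have hs : X B (n + m) ⁅y, x⁆ = -X B (n + m) ⁅x, y⁆ := by
          rw [← lie_skew x y, map_neg, neg_neg]
        rw [X_lie_X, X_lie_X, B.symm y x, add_comm m n, hs]
        by_cases h : n + m = 0
        · obtain rfl : m = -n := by omega
          simp only [h, if_true, Int.cast_neg]
          module
        · simp only [h, if_false]
          module
      · change ⁅X B n x, L B m⁆ = -⁅L B m, X B n x⁆
        rw [X_lie_L, L_lie_X]
      · change ⁅X B n x, K B⁆ = -⁅K B, X B n x⁆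
        simp [K_lie, lie_K]
    · refine hom_ext (fun m y => ?_) (fun m => ?_) ?_
      · change ⁅L B n, X B m y⁆ = -⁅X B m y, L B n⁆
        rw [X_lie_L, L_lie_X, neg_neg]
      · change ⁅L B n, L B m⁆ = -⁅L B m, L B n⁆
        rw [L_lie_L, L_lie_L, add_comm m n]
        by_cases h : n + m = 0
        · obtain rfl : m = -n := by omega
          simp
          module
        · simp only [h, if_false]
          module
      · change ⁅L B n, K B⁆ = -⁅K B, L B n⁆
        simp [K_lie, lie_K]
    · refine hom_ext (fun m y => ?_) (fun m => ?_) ?_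
      · change ⁅K B, X B m y⁆ = -⁅X B m y, K B⁆
        simp [K_lie, lie_K]
      · change ⁅K B, L B m⁆ = -⁅L B m, K B⁆
        simp [K_lie, lie_K]
      · change ⁅K B, K B⁆ = -⁅K B, K B⁆
        simp [K_lie]
  exact LinearMap.congr_fun₂ this u v

lemma add_lie_aux (u v w : Tau B) : ⁅u + v, w⁆ = ⁅u, w⁆ + ⁅v, w⁆ := by simp [lie_def]
lemma lie_add_aux (u v w : Tau B) : ⁅u, v + w⁆ = ⁅u, v⁆ + ⁅u, w⁆ := by simp [lie_def]
lemma smul_lie_aux (c : ℂ) (u v : Tau B) : ⁅c • u, v⁆ = c • ⁅u, v⁆ := by simp [lie_def]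
lemma lie_smul_aux (c : ℂ) (u v : Tau B) : ⁅u, c • v⁆ = c • ⁅u, v⁆ := by simp [lie_def]
lemma neg_lie_aux (u v : Tau B) : ⁅-u, v⁆ = -⁅u, v⁆ := by simp [lie_def]
lemma lie_neg_aux (u v : Tau B) : ⁅u, -v⁆ = -⁅u, v⁆ := by simp [lie_def]
lemma zero_lie_aux (u : Tau B) : ⁅(0 : Tau B), u⁆ = 0 := by simp [lie_def]
lemma lie_zero_aux (u : Tau B) : ⁅u, (0 : Tau B)⁆ = 0 := by simp [lie_def]

/-- The Jacobi identity, in Leibniz form, for three given elements. -/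
def Jac (u v w : Tau B) : Prop := ⁅u, ⁅v, w⁆⁆ = ⁅⁅u, v⁆, w⁆ + ⁅v, ⁅u, w⁆⁆

variable {B} in
lemma Jac.swap {u v w : Tau B} (h : Jac B u v w) : Jac B v u w := by
  unfold Jac at *
  rw [h, skew B v u, neg_lie_aux]
  abel

variable {B} in
lemma Jac.swap' {u v w : Tau B} (h : Jac B u v w) : Jac B u w v := by
  unfold Jac at *
  rw [skew B w v, lie_neg_aux, h, skew B ⁅u, w⁆ v, skew B w ⁅u, v⁆]
  abel

lemma jac_K (v w : Tau B) : Jac B (K B) v w := by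
  simp [Jac, K_lie, zero_lie_aux, lie_zero_aux]

lemma jac_XXX (n m p : ℤ) (x y z : g) : Jac B (X B n x) (X B m y) (X B p z) := by
  unfold Jac
  have e1 : X B (n + (m + p)) ⁅x, ⁅y, z⁆⁆ =
      X B (n + (m + p)) ⁅⁅x, y⁆, z⁆ + X B (n + (m + p)) ⁅y, ⁅x, z⁆⁆ := by
    rw [leibniz_lie, map_add]
  have i1 : B.form ⁅x, y⁆ z = B.form x ⁅y, z⁆ := B.invariant x y z
  have i2 : B.form y ⁅x, z⁆ = -B.form x ⁅y, z⁆ := by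
    rw [← B.invariant, ← lie_skew, map_neg, LinearMap.neg_apply, i1]
  simp only [X_lie_X, lie_add_aux, add_lie_aux, lie_smul_aux, smul_lie_aux, K_lie, lie_K,
    smul_zero, add_zero]
  rw [show n + m + p = n + (m + p) by ring, show m + (n + p) = n + (m + p) by ring, e1, i1, i2]
  by_cases h : n + (m + p) = 0
  · obtain rfl : p = -n - m := by omega
    simp only [h, if_true]
    push_cast
    module
  · simp only [h, if_false]
    module

lemma jac_LXX (n m p : ℤ) (y z : g) : Jac B (L B n) (X B m y) (X B p z) := by
  unfold Jac
  simp only [X_lie_X, L_lie_X, lie_add_aux, lie_smul_aux, smul_lie_aux, lie_K,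
    smul_zero, add_zero]
  rw [show m + n + p = m + p + n by ring, show m + (p + n) = m + p + n by ring]
  by_cases h : m + p + n = 0
  · obtain rfl : n = -m - p := by omega
    simp only [h, if_true]
    push_cast
    module
  · simp only [h, if_false]
    push_cast
    module

lemma jac_LLX (n m p : ℤ) (z : g) : Jac B (L B n) (L B m) (X B p z) := by
  unfold Jac
  simp only [L_lie_L, L_lie_X, add_lie_aux, lie_smul_aux, smul_lie_aux, K_lie,
    smul_zero, add_zero]
  rw [show p + (n + m) = p + m + n by ring, show p + n + m = p + m + n by ring]
  push_cast
  module

lemma jac_LLL (n m p : ℤ) : Jac B (L B n) (L B m) (L B p) := by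
  unfold Jac
  simp only [L_lie_L, lie_add_aux, add_lie_aux, lie_smul_aux, smul_lie_aux, K_lie, lie_K,
    smul_zero, add_zero]
  rw [show n + m + p = n + (m + p) by ring, show m + (n + p) = n + (m + p) by ring]
  by_cases h : n + (m + p) = 0
  · obtain rfl : p = -n - m := by omega
    simp only [h, if_true]
    push_cast
    module
  · simp only [h, if_false]
    push_cast
    module

variable {B} in
/-- The Jacobi identity holds if it holds when the first element is a generator. -/
lemma jac_ind {v w : Tau B} (hX : ∀ n x, Jac B (X B n x) v w) (hL : ∀ n, Jac B (L B n) v w)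
    (u : Tau B) : Jac B u v w := by
  refine ind (P := fun u => Jac B u v w) (fun a b ha hb => ?_) (fun c a ha => ?_) hX hL
    (jac_K B v w) u
  · unfold Jac at *
    simp only [add_lie_aux, lie_add_aux, ha, hb]
    abel
  · unfold Jac at *
    simp only [smul_lie_aux, lie_smul_aux, ha, smul_add]

lemma jacobi (u v w : Tau B) : ⁅u, ⁅v, w⁆⁆ = ⁅⁅u, v⁆, w⁆ + ⁅v, ⁅u, w⁆⁆ := by
  refine jac_ind (fun n x => ?_) (fun n => ?_) u
  · refine Jac.swap (jac_ind (fun m y => ?_) (fun m => ?_) v)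
    · refine Jac.swap (Jac.swap' (Jac.swap (jac_ind (fun p z => ?_) (fun p => ?_) w)))
      · exact jac_XXX B _ _ _ _ _ _
      · exact jac_LXX B _ _ _ _ _
    · refine Jac.swap (Jac.swap' (Jac.swap (jac_ind (fun p z => ?_) (fun p => ?_) w)))
      · exact (jac_LXX B m p n z x).swap.swap'
      · exact (jac_LLX B p m n x).swap'
  · refine Jac.swap (jac_ind (fun m y => ?_) (fun m => ?_) v)
    · refine Jac.swap (Jac.swap' (Jac.swap (jac_ind (fun p z => ?_) (fun p => ?_) w)))
      · exact (jac_LXX B n p m z y).swap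
      · exact jac_LLX B _ _ _ _
    · refine Jac.swap (Jac.swap' (Jac.swap (jac_ind (fun p z => ?_) (fun p => ?_) w)))
      · exact (jac_LLX B n m p z).swap'.swap
      · exact jac_LLL B _ _ _

instance : LieRing (Tau B) where
  add_lie := add_lie_aux B
  lie_add := lie_add_aux B
  lie_self u := by
    have h := skew B u u
    have h2 : (2 : ℂ) • ⁅u, u⁆ = 0 := by
      rw [two_smul]
      nth_rewrite 1 [h]
      exact neg_add_cancel _
    exact (smul_eq_zero.mp h2).resolve_left two_ne_zero
  leibniz_lie := jacobi B

instance : LieAlgebra ℂ (Tau B) where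
  lie_smul := lie_smul_aux B

/-- The affine Lie algebra `g̃ = g ⊗ ℂ[t, t⁻¹] ⊕ ℂ K`, as a subalgebra of `τ`. -/
def affine : LieSubalgebra ℂ (Tau B) where
  carrier := {u | u.2.1 = 0}
  add_mem' {u v} hu hv := by
    change u.2.1 + v.2.1 = 0
    rw [show u.2.1 = 0 from hu, show v.2.1 = 0 from hv, add_zero]
  zero_mem' := rfl
  smul_mem' c u hu := by
    change c • u.2.1 = 0
    rw [show u.2.1 = 0 from hu, smul_zero]
  lie_mem' {u v} hu hv := by
    let S : Submodule ℂ (Tau B) :=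
      LinearMap.ker (LinearMap.fst ℂ (ℤ →₀ ℂ) ℂ ∘ₗ LinearMap.snd ℂ (ℤ →₀ g) ((ℤ →₀ ℂ) × ℂ))
    have hXS : ∀ n x, X B n x ∈ S := fun n x => rfl
    have hKS : K B ∈ S := rfl
    have key : ∀ w : Tau B, w.2.1 = 0 →
        w = lift B (fun n => X B n) (fun _ => 0) (K B) w := by
      intro w hw
      have h1 : LinearMap.id = lift B (fun n => X B n) (fun n => L B n) (K B) :=
        by
        refine hom_ext (fun n x => ?_) (fun n => ?_) ?_
        · rw [lift_X, LinearMap.id_apply]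
        · rw [lift_L, LinearMap.id_apply]
        · rw [lift_K, LinearMap.id_apply]
      have h2 : lift B (fun n => X B n) (fun n => L B n) (K B) w =
          lift B (fun n => X B n) (fun _ => 0) (K B) w := by
        change Finsupp.lsum ℂ (fun n => X B n) w.1 +
          (Finsupp.lsum ℂ (fun n => LinearMap.toSpanSingleton ℂ (Tau B) (L B n)) w.2.1 +
            w.2.2 • K B) = Finsupp.lsum ℂ (fun n => X B n) w.1 +
          (Finsupp.lsum ℂ (fun _ : ℤ => LinearMap.toSpanSingleton ℂ (Tau B) 0) w.2.1 + w.2.2 • K B)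
        rw [hw, map_zero, map_zero]
      exact (LinearMap.congr_fun h1 w).trans h2
    let p : Tau B →ₗ[ℂ] Tau B := lift B (fun n => X B n) (fun _ => 0) (K B)
    have hp : ∀ u' v' : Tau B, ⁅p u', p v'⁆ ∈ S := by
      intro u' v'
      refine ind (P := fun u' => ⁅p u', p v'⁆ ∈ S) (fun a b ha hb => ?_) (fun c a ha => ?_)
        (fun n x => ?_) (fun n => ?_) ?_ u'
      · simp only [map_add, add_lie]
        exact S.add_mem ha hb
      · simp only [map_smul, smul_lie_aux]
        exact S.smul_mem c ha
      · refine ind (P := fun v' => ⁅p (X B n x), p v'⁆ ∈ S) (fun a b ha hb => ?_)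
          (fun c a ha => ?_) (fun m y => ?_) (fun m => ?_) ?_ v'
        · simp only [map_add, lie_add]
          exact S.add_mem ha hb
        · simp only [map_smul, lie_smul]
          exact S.smul_mem c ha
        · simp only [p, lift_X, X_lie_X]
          exact S.add_mem (hXS _ _) (S.smul_mem _ hKS)
        · simp [p, lift_L]
        · simp [p, lift_K, lie_K]
      · simp [p, lift_L]
      · simp [p, lift_K, K_lie]
    have := hp u v
    rw [← key u hu, ← key v hv] at this
    exact this

end Tau
end Tau

/-! ### Roots -/

section Roots

open LieAlgebra LieModule

variable {g : Type*} [LieRing g] [LieAlgebra ℂ g]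

/-- The Cartan subalgebra `h̄ = h ⊕ ℂ K ⊕ ℂ d` with `d = L₀`; the triple `(h, c, e)` stands for
`h + c K + e d`. -/
abbrev AffCartan (H : LieSubalgebra ℂ g) : Type _ := H × ℂ × ℂ

/-- The inclusion of `h̄` in `τ`. -/
def AffCartan.toTau (B : InvariantForm g) (H : LieSubalgebra ℂ g) : AffCartan H →ₗ[ℂ] Tau B :=
  LinearMap.coprod (Tau.X B 0 ∘ₗ H.toSubmodule.subtype)
    (LinearMap.coprod (LinearMap.toSpanSingleton ℂ _ (Tau.K B))
      (LinearMap.toSpanSingleton ℂ _ (Tau.L B 0)))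

/-- The map `γ : h̄ → h̄*`, `γ(s)(s') = (s, s')`, where the bilinear form on `h̄` extends the one
on `h` by `(K, d) = 1`, `(K, K) = (d, d) = 0`, `(K, h) = (d, h) = 0`. -/
def gammaMap (B : InvariantForm g) (H : LieSubalgebra ℂ g) :
    AffCartan H →ₗ[ℂ] Module.Dual ℂ (AffCartan H) :=
  LinearMap.mk₂ ℂ (fun s s' => B.form s.1 s'.1 + s.2.1 * s'.2.2 + s.2.2 * s'.2.1)
    (fun s₁ s₂ s' => by simp; ring) (fun c s s' => by simp; ring)
    (fun s s₁ s₂ => by simp; ring) (fun c s s' => by simp; ring)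

variable [FiniteDimensional ℂ g] [LieAlgebra.IsSimple ℂ g]
variable (B : InvariantForm g) (H : LieSubalgebra ℂ g) [H.IsCartanSubalgebra]

/-- An invariant form which is non-degenerate on `g` is non-degenerate on a Cartan subalgebra. -/
lemma form_nondegenerate_cartan (h : H) (hh : ∀ h' : H, B.form h h' = 0) : h = 0 := by
  have key : ∀ y : g, B.form h y = 0 := by
    intro y
    have hy : y ∈ (⨆ α : Weight ℂ H g, genWeightSpace g α : LieSubmodule ℂ H g) := by
      rw [iSup_genWeightSpace_eq_top' ℂ H g]
      trivial
    induction hy using LieSubmodule.iSup_induction' with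
    | zero => simp
    | add a b _ _ ha hb => simp [ha, hb]
    | mem α y hy =>
      by_cases hα : α.IsZero
      · have : y ∈ rootSpace H (0 : H → ℂ) := by
          have h0 : (α : H → ℂ) = 0 := hα
          rw [← h0]
          exact hy
        rw [rootSpace_zero_eq] at this
        exact hh ⟨y, this⟩
      · obtain ⟨k, hk⟩ : ∃ k : H, α k ≠ 0 := by
          by_contra hcon
          push Not at hcon
          exact hα (funext hcon)
        have h1 : ⁅(k : g), y⁆ = α k • y := IsKilling.lie_eq_smul_of_mem_rootSpace hy k
        have h2 : ⁅(h : g), (k : g)⁆ = 0 := by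
          have : ⁅h, k⁆ = 0 := trivial_lie_zero H H h k
          simpa using congrArg (Subtype.val) this
        have h3 := B.invariant (h : g) (k : g) y
        rw [h1, h2] at h3
        simpa [hk] using h3.symm
  exact Subtype.ext (B.nondegenerate _ key)

lemma gammaMap_injective : Function.Injective (gammaMap B H) := by
  rw [← LinearMap.ker_eq_bot, LinearMap.ker_eq_bot']
  rintro ⟨h, c, e⟩ hs
  have h1 : h = 0 := form_nondegenerate_cartan B H h fun h' => by
    simpa [gammaMap] using LinearMap.congr_fun hs (h', 0, 0)
  have h2 : c = 0 := by simpa [gammaMap] using LinearMap.congr_fun hs (0, 0, 1)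
  have h3 : e = 0 := by simpa [gammaMap] using LinearMap.congr_fun hs (0, 1, 0)
  simp [h1, h2, h3]

/-- The isomorphism `γ : h̄ → h̄*`. -/
def gamma : AffCartan H ≃ₗ[ℂ] Module.Dual ℂ (AffCartan H) :=
  (gammaMap B H).linearEquivOfInjective (gammaMap_injective B H) Subspace.dual_finrank_eq.symm

/-- The bilinear form on `h̄*` induced by the one on `h̄` through `γ`. -/
def dualForm (μ ν : Module.Dual ℂ (AffCartan H)) : ℂ :=
  gammaMap B H ((gamma B H).symm μ) ((gamma B H).symm ν)

variable {H}

/-- The functional `α + n δ` on `h̄`: `α` is extended by `α(K) = α(d) = 0`, and `δ` vanishes on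
`h` and `K`, with `δ(d) = 1`. -/
def affineWeight (α : Module.Dual ℂ H) (n : ℤ) : Module.Dual ℂ (AffCartan H) :=
  α ∘ₗ LinearMap.fst ℂ H (ℂ × ℂ) +
    (n : ℂ) • (LinearMap.snd ℂ ℂ ℂ ∘ₗ LinearMap.snd ℂ H (ℂ × ℂ))

/-- The affine roots: `α + n δ` with `α` a root of `g`, and `n δ` with `n ≠ 0`. -/
def IsAffineRoot (μ : Module.Dual ℂ (AffCartan H)) : Prop :=
  (∃ α ∈ H.root, ∃ n : ℤ, μ = affineWeight (Weight.toLinear ℂ H g α) n) ∨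
    (∃ n : ℤ, n ≠ 0 ∧ μ = affineWeight 0 n)

/-- `θ` is the highest root with respect to the base `b`: for each root `α`, the difference
`θ - α` is a sum of simple roots. -/
def IsHighestRoot (b : (IsKilling.rootSystem H).Base) (θ : H.root) : Prop :=
  ∀ α : H.root, (IsKilling.rootSystem H).root θ - (IsKilling.rootSystem H).root α ∈
    AddSubmonoid.closure ((IsKilling.rootSystem H).root '' b.support)

/-- The simple roots of the affine algebra: those of `g`, and `α₀ = -θ + δ` (indexed by `none`). -/
def affineSimpleRoot (b : (IsKilling.rootSystem H).Base) (θ : H.root) :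
    Option b.support → Module.Dual ℂ (AffCartan H)
  | none => affineWeight (-(IsKilling.rootSystem H).root θ) 1
  | some i => affineWeight ((IsKilling.rootSystem H).root i) 0

/-- The root space `τ_μ` of `τ`. -/
def rootSubspace (μ : Module.Dual ℂ (AffCartan H)) : Submodule ℂ (Tau B) where
  carrier := {u | ∀ s, ⁅AffCartan.toTau B H s, u⁆ = μ s • u}
  add_mem' hu hv s := by rw [lie_add, hu s, hv s, smul_add]
  zero_mem' s := by simp
  smul_mem' c u hu s := by rw [lie_smul, hu s, smul_comm]

/-- The choices entering the Casimir operator: a functional `ρ` on `h̄` with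
`(ρ, αᵢ) = (αᵢ, αᵢ)/2` for all affine simple roots, bases `hᵢ`, `hⁱ` of `h` dual to each other, and
root vectors `x_α` with `(x_α, x_{-α}) = 1`. -/
structure CasimirData (b : (IsKilling.rootSystem H).Base) (θ : H.root) where
  ρ : Module.Dual ℂ (AffCartan H)
  rho_spec : ∀ i, dualForm B H ρ (affineSimpleRoot b θ i) =
    dualForm B H (affineSimpleRoot b θ i) (affineSimpleRoot b θ i) / 2
  h : Module.Basis (Fin (Module.finrank ℂ H)) ℂ H
  h' : Module.Basis (Fin (Module.finrank ℂ H)) ℂ H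
  dual : ∀ i j, B.form (h i) (h' j) = if i = j then 1 else 0
  x : Weight ℂ H g → g
  x_mem : ∀ α ∈ H.root, x α ∈ rootSpace H α
  x_pair : ∀ α ∈ H.root, B.form (x α) (x (-α)) = 1

end Roots

/-! ### Modules over the loop algebra `τ(A) = τ ⊗ A` -/

section Modules

open LieAlgebra LieModule

variable {g : Type*} [LieRing g] [LieAlgebra ℂ g]
variable {A : Type*} [CommRing A] [Algebra ℂ A] {B : InvariantForm g}
variable (V : Type*) [AddCommGroup V] [Module ℂ V] [LieRingModule (A ⊗[ℂ] Tau B) V]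
  [LieModule ℂ (A ⊗[ℂ] Tau B) V]

variable {V} in
/-- The action of `u(a) = u ⊗ a` on a `τ(A)`-module. -/
def act (u : Tau B) (a : A) : V →ₗ[ℂ] V := LieModule.toEnd ℂ (A ⊗[ℂ] Tau B) V (a ⊗ₜ[ℂ] u)

variable (A B)

/-- The weight space `V_μ` with respect to `h̄ = h̄ ⊗ 1`. -/
def weightSubspace {H : LieSubalgebra ℂ g} (μ : Module.Dual ℂ (AffCartan H)) : Submodule ℂ V where
  carrier := {v | ∀ s, act (AffCartan.toTau B H s) (1 : A) v = μ s • v}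
  add_mem' hu hv s := by rw [map_add, hu s, hv s, smul_add]
  zero_mem' s := by simp
  smul_mem' c u hu s := by rw [map_smul, hu s, smul_comm]

/-- `z` is an affine central operator on `V`: a linear operator which commutes with the action of
`g̃ = g̃ ⊗ 1`. -/
def IsAffineCentral (z : V → V) : Prop :=
  IsLinearMap ℂ z ∧ ∀ y ∈ Tau.affine B, ∀ v : V, z (act y (1 : A) v) = act y (1 : A) (z v)

variable [FiniteDimensional ℂ g] [LieAlgebra.IsSimple ℂ g] {H : LieSubalgebra ℂ g}
  [H.IsCartanSubalgebra] (b : (IsKilling.rootSystem H).Base) (θ : H.root)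

open Classical in
/-- The category `𝒪` of `τ(A)`-modules: weight modules with finite-dimensional weight spaces on
which, for all `v` and `a`, the operators `u(a)` with `u ∈ τ_μ` kill `v` for all positive affine
roots `μ` of large height. A positive root is written as `μ = ∑ cᵢ αᵢ` with natural
numbers `cᵢ`; its height is `∑ cᵢ`. -/
structure CategoryO : Prop where
  weight : DirectSum.IsInternal
    (fun μ : Module.Dual ℂ (AffCartan H) => weightSubspace A B V μ)
  finite : ∀ μ : Module.Dual ℂ (AffCartan H), FiniteDimensional ℂ (weightSubspace A B V μ)
  locally_nilpotent : ∀ (v : V) (a : A), ∃ N : ℕ, ∀ c : Option b.support → ℕ, N ≤ ∑ i, c i →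
    IsAffineRoot (∑ i, c i • affineSimpleRoot b θ i) →
    ∀ u ∈ rootSubspace B (∑ i, c i • affineSimpleRoot b θ i), act u a v = 0

variable {A B V b θ}
variable (D : CasimirData B b θ)

/-- The `(α, n)`-term of `Ω¹_{a,a'}`, applied to `v`. -/
def omega1Term (a a' : A) (v : V) (α : Weight ℂ H g) (n : ℕ+) : V :=
  act (Tau.X B (-(n : ℤ)) (D.x (-α))) a (act (Tau.X B n (D.x α)) a' v)

/-- The `(i, n)`-term of `Ω²_{a,a'}`, applied to `v`. -/
def omega2Term (a a' : A) (v : V) (i : Fin (Module.finrank ℂ H)) (n : ℕ+) : V :=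
  act (Tau.X B (-(n : ℤ)) (D.h i : g)) a (act (Tau.X B n (D.h' i : g)) a' v)

/-- `Ω¹_{a,a'} = ∑_α ∑_{n>0} (x_{-α} ⊗ t⁻ⁿ)(a) (x_α ⊗ tⁿ)(a')`. -/
def omega1 (a a' : A) (v : V) : V := ∑ α ∈ H.root, ∑ᶠ n : ℕ+, omega1Term D a a' v α n

/-- `Ω²_{a,a'} = ∑_i ∑_{n>0} (hᵢ ⊗ t⁻ⁿ)(a) (hⁱ ⊗ tⁿ)(a')`. -/
def omega2 (a a' : A) (v : V) : V := ∑ i, ∑ᶠ n : ℕ+, omega2Term D a a' v i n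

open Classical in
/-- `Ω³_{a,a'} = ∑_{α > 0} x_{-α}(a) x_α(a')`. -/
def omega3 (a a' : A) (v : V) : V :=
  ∑ α : H.root with b.IsPos α, act (Tau.X B 0 (D.x (-(α : Weight ℂ H g)))) a
    (act (Tau.X B 0 (D.x α)) a' v)

/-- For each `v`, the sums over `n > 0` in `Ω¹_{a,a'}` and `Ω²_{a,a'}` have only finitely many
non-zero terms. -/
def LocallyFinite (V : Type*) [AddCommGroup V] [Module ℂ V] [LieRingModule (A ⊗[ℂ] Tau B) V]
    [LieModule ℂ (A ⊗[ℂ] Tau B) V] (a a' : A) : Prop :=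
  ∀ v : V, (∀ α ∈ H.root, {n : ℕ+ | omega1Term D a a' v α n ≠ 0}.Finite) ∧
    ∀ i, {n : ℕ+ | omega2Term D a a' v i n ≠ 0}.Finite

/-- The operator `Ω(a,a') = 2γ⁻¹(ρ)(aa') + ∑ hᵢ(a)hⁱ(a') + K(a)d(a') + K(a')d(a) + Ω¹_{a,a'} + Ω¹_{a',a}
+ Ω²_{a,a'} + Ω²_{a',a} + Ω³_{a,a'} + Ω³_{a',a}`, with `d = L₀`. -/
def omega (a a' : A) (v : V) : V :=
  (2 : ℂ) • act (AffCartan.toTau B H ((gamma B H).symm D.ρ)) (a * a') v +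
    ∑ i, act (Tau.X B 0 (D.h i : g)) a (act (Tau.X B 0 (D.h' i : g)) a' v) +
    act (Tau.K B) a (act (Tau.L B 0) a' v) + act (Tau.K B) a' (act (Tau.L B 0) a v) +
    omega1 D a a' v + omega1 D a' a v + omega2 D a a' v + omega2 D a' a v +
    omega3 D a a' v + omega3 D a' a v

/-- `T₀(a,a') = Ω(a,a')` and `T_j(a,a') = -(1/j) [L_j, Ω(a,a')]` for `j ≠ 0`, where
`L_j = L_j ⊗ 1`. -/
def T (j : ℤ) (a a' : A) (v : V) : V :=
  if j = 0 then omega D a a' v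
  else (-1 / (j : ℂ)) • (act (Tau.L B j) (1 : A) (omega D a a' v) -
    omega D a a' (act (Tau.L B j) (1 : A) v))

end Modules
end LoopAffineVirasoro

end

noncomputable section

namespace LoopAffineVirasoro

/-! This is a Sugawara-type computation. Let `uᵢ`, `u'ᵢ` be the dual families of g made of the root
vectors and the bases of h. Since `∑_{α>0} [x_α, x_{-α}]` is twice the h-component of `γ⁻¹(ρ)`,
normal ordering of the zero modes is exactly undone by that part of Ω. Thus Ω(a,a') is `∑ uᵢ(a)
u'ᵢ(a')`, plus the sums `∑ uᵢ(-n)(a) u'ᵢ(n)(a')` over n > 0 symmetrised in a, a', plus terms in K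
and d (`pairSum_fam_zero`, `omega_eq_omegaTrunc`). For n > 0 the root α + nδ has height at least n,
so on a given vector all these sums may be truncated.

Commuting y(m) past the n-th mode gives `P(n) - P(n+m)`, where `P(n) = ∑ [y,uᵢ](m-n)(a) u'ᵢ(n)(a')`,
together with central terms for n = ±m (`IsDualFamily.act_mul_pairSum`). The central terms cancel
against `K(a)d(a') + K(a')d(a)`. The differences telescope, but not to zero: with P' denoting P for
a, a' exchanged, reordering two factors gives `P(k) + P'(m-k) = (Cy)(m)(aa')` for m ≠ 0, where C is
the Casimir of the adjoint representation. The total defect is m times this (`sum_sub_shift_add`).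

By simplicity C is a scalar, equal on the highest root vector to (θ,θ) + 2(ρ,θ). The condition on ρ
at α₀ says that this is 2ρ(K), twice the d-coefficient of `γ⁻¹(ρ)` (`CasimirData.casimir_eq`). So
the defect is cancelled by the commutator of y(m) with `2ρ(K) d(aa')`, and Ω commutes with the
affine algebra. For j ≠ 0, ad L_j preserves the affine algebra, so the commutator of L_j with Ω is
again central (`IsAffineCentral.lie_L`). -/

open LieAlgebra LieModule

/-! ### Dual families and the Casimir operator. -/

section DualFamily

variable {g : Type*} [LieRing g] [LieAlgebra ℂ g]

/-- Two finite families in `g` which are dual with respect to the form: each element of `g` can be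
expanded in either family, with coefficients computed by pairing with the other one. -/
structure IsDualFamily (B : InvariantForm g) {ι : Type*} [Fintype ι] (u u' : ι → g) : Prop where
  expand : ∀ y, ∑ i, B.form y (u i) • u' i = y
  expand' : ∀ y, ∑ i, B.form y (u' i) • u i = y

namespace IsDualFamily

variable {B : InvariantForm g} {ι : Type*} [Fintype ι] {u u' : ι → g}

/-- The Gram matrix `B(uᵢ, uⱼ)` is symmetric, and both sides are its contraction with F on the
family `u'`. -/
lemma sum_swap (h : IsDualFamily B u u') {M : Type*} [AddCommGroup M] [Module ℂ M]
    (F : g →ₗ[ℂ] g →ₗ[ℂ] M) : ∑ i, F (u i) (u' i) = ∑ i, F (u' i) (u i) := by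
  have h1 : ∀ i, F (u i) (u' i) = ∑ j, B.form (u i) (u j) • F (u' j) (u' i) := fun i => by
    conv_lhs => rw [← h.expand (u i)]
    simp
  have h2 : ∀ i, F (u' i) (u i) = ∑ j, B.form (u i) (u j) • F (u' i) (u' j) := fun i => by
    conv_lhs => rw [← h.expand (u i)]
    simp
  simp_rw [h1, h2]
  rw [Finset.sum_comm]
  simp_rw [B.symm]

/-- The canonical tensor `∑ uᵢ ⊗ u'ᵢ` is invariant under ad y, because ad y is skew for an invariant
form. -/
lemma sum_lie (h : IsDualFamily B u u') {M : Type*} [AddCommGroup M] [Module ℂ M]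
    (F : g →ₗ[ℂ] g →ₗ[ℂ] M) (y : g) :
    ∑ i, F (u i) ⁅y, u' i⁆ = -∑ i, F ⁅y, u i⁆ (u' i) := by
  have h1 : ∀ i, F ⁅y, u i⁆ (u' i) = ∑ j, B.form ⁅y, u i⁆ (u' j) • F (u j) (u' i) := fun i => by
    conv_lhs => rw [← h.expand' ⁅y, u i⁆]
    simp
  have h2 : ∀ j, F (u j) ⁅y, u' j⁆ = ∑ i, B.form ⁅y, u' j⁆ (u i) • F (u j) (u' i) := fun i => by
    conv_lhs => rw [← h.expand ⁅y, u' i⁆]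
    simp
  have h3 : ∀ i j, B.form ⁅y, u' j⁆ (u i) = -B.form ⁅y, u i⁆ (u' j) := fun i j => by
    rw [B.symm, ← B.invariant, ← lie_skew, map_neg, LinearMap.neg_apply]
  simp_rw [h1, h2, h3]
  rw [Finset.sum_comm]
  simp

variable (u u') in
/-- The Casimir operator `∑ᵢ ad uᵢ ∘ ad u'ᵢ` on `g`. -/
def casimir : g →ₗ[ℂ] g := ∑ i, LieAlgebra.ad ℂ g (u i) ∘ₗ LieAlgebra.ad ℂ g (u' i)

lemma casimir_apply (y : g) : casimir u u' y = ∑ i, ⁅u i, ⁅u' i, y⁆⁆ := by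
  simp [casimir]

/-- Interchanging the two families and changing two signs gives this form, the one that appears when
two modes are reordered. -/
lemma casimir_apply' (h : IsDualFamily B u u') (y : g) :
    casimir u u' y = ∑ i, ⁅⁅y, u i⁆, u' i⁆ := by
  have h1 := h.sum_swap (LinearMap.mk₂ ℂ (fun p q => ⁅p, ⁅q, y⁆⁆)
    (by intros; simp) (by intros; simp) (by intros; simp) (by intros; simp))
  simp only [LinearMap.mk₂_apply] at h1
  rw [casimir_apply, h1]
  refine Finset.sum_congr rfl fun i _ => ?_
  rw [← lie_skew y (u i), neg_lie, lie_skew]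

/-- By Leibniz the difference consists of the two terms where z acts on `uᵢ` or `u'ᵢ`; they cancel
by `sum_lie`. -/
lemma casimir_lie (h : IsDualFamily B u u') (z y : g) :
    casimir u u' ⁅z, y⁆ = ⁅z, casimir u u' y⁆ := by
  have h1 := h.sum_lie (LinearMap.mk₂ ℂ (fun p q => ⁅p, ⁅q, y⁆⁆)
    (by intros; simp) (by intros; simp) (by intros; simp) (by intros; simp)) z
  simp only [LinearMap.mk₂_apply] at h1
  simp_rw [casimir_apply, lie_sum]
  have h2 : ∀ i, ⁅z, ⁅u i, ⁅u' i, y⁆⁆⁆ =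
      ⁅u i, ⁅u' i, ⁅z, y⁆⁆⁆ + (⁅⁅z, u i⁆, ⁅u' i, y⁆⁆ + ⁅u i, ⁅⁅z, u' i⁆, y⁆⁆) := fun i => by
    rw [leibniz_lie z (u i), leibniz_lie z (u' i), lie_add]
    abel
  simp_rw [h2, Finset.sum_add_distrib, h1]
  simp

end IsDualFamily

end DualFamily

/-! ### Root vectors, the Cartan subalgebra and their duality. -/

section RootData

variable {g : Type*} [LieRing g] [LieAlgebra ℂ g] [FiniteDimensional ℂ g] [LieAlgebra.IsSimple ℂ g]
variable {B : InvariantForm g} {H : LieSubalgebra ℂ g} [H.IsCartanSubalgebra]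

omit [LieAlgebra.IsSimple ℂ g] in
/-- A linear map on `g` vanishes if it does so on `h` and on all root spaces. -/
lemma linearMap_eq_zero_of_rootSpace {M : Type*} [AddCommGroup M] [Module ℂ M] (f : g →ₗ[ℂ] M)
    (h0 : ∀ h : H, f h = 0) (hr : ∀ α ∈ H.root, ∀ y ∈ rootSpace H α, f y = 0) : f = 0 := by
  ext y
  have hy : y ∈ (⨆ α : Weight ℂ H g, genWeightSpace g α : LieSubmodule ℂ H g) := by
    rw [iSup_genWeightSpace_eq_top' ℂ H g]
    trivial
  induction hy using LieSubmodule.iSup_induction' with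
  | zero => simp
  | add a b _ _ ha hb => simp_all
  | mem α y hy =>
    by_cases hα : α.IsZero
    · have : y ∈ rootSpace H (0 : H → ℂ) := by
        have h0 : (α : H → ℂ) = 0 := hα
        rw [← h0]
        exact hy
      rw [rootSpace_zero_eq] at this
      exact h0 ⟨y, this⟩
    · exact hr α (by simpa using hα) y hy

lemma form_eq_zero_of_rootSpace {α β : H → ℂ} {x y : g} (hx : x ∈ rootSpace H α)
    (hy : y ∈ rootSpace H β) (hαβ : α + β ≠ 0) : B.form x y = 0 := by
  obtain ⟨k, hk⟩ : ∃ k : H, α k + β k ≠ 0 := by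
    by_contra hcon
    push Not at hcon
    exact hαβ (funext hcon)
  have h1 : ⁅(k : g), x⁆ = α k • x := IsKilling.lie_eq_smul_of_mem_rootSpace hx k
  have h2 : ⁅(k : g), y⁆ = β k • y := IsKilling.lie_eq_smul_of_mem_rootSpace hy k
  have h3 := B.invariant x (k : g) y
  rw [← lie_skew, h1, h2] at h3
  simp only [map_neg, map_smul, LinearMap.neg_apply, LinearMap.smul_apply, smul_eq_mul] at h3
  have h4 : (α k + β k) * B.form x y = 0 := by linear_combination -h3
  exact (mul_eq_zero.mp h4).resolve_left hk

omit [LieAlgebra.IsSimple ℂ g] in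
lemma cartan_mem_rootSpace_zero (h : H) : (h : g) ∈ rootSpace H (0 : H → ℂ) := by
  rw [rootSpace_zero_eq]
  exact h.2

namespace CasimirData

variable {b : (IsKilling.rootSystem H).Base} {θ : H.root} (D : CasimirData B b θ)

/-- The index set of the dual families below: the roots, and the basis of `h`. -/
abbrev Index (H : LieSubalgebra ℂ g) [H.IsCartanSubalgebra] : Type _ :=
  H.root ⊕ Fin (Module.finrank ℂ H)

/-- The family consisting of the root vectors `x_{-α}` and of the `hᵢ`. -/
def fam : Index H → g := Sum.elim (fun α => D.x (-α)) (fun i => D.h i)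

/-- The family consisting of the root vectors `x_α` and of the `hⁱ`. -/
def fam' : Index H → g := Sum.elim (fun α => D.x α) (fun i => D.h' i)

lemma neg_mem_root {α : Weight ℂ H g} (hα : α ∈ H.root) : -α ∈ H.root := by
  simpa using hα

lemma x_neg_mem {α : Weight ℂ H g} (hα : α ∈ H.root) : D.x (-α) ∈ rootSpace H (-α : H → ℂ) := by
  simpa using D.x_mem (-α) (neg_mem_root hα)

lemma x_ne_zero {α : Weight ℂ H g} (hα : α ∈ H.root) : D.x α ≠ 0 := fun h => by
  simpa [h] using D.x_pair α hα

lemma exists_smul_x {α : Weight ℂ H g} (hα : α ∈ H.root) {y : g} (hy : y ∈ rootSpace H α) :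
    ∃ c : ℂ, y = c • D.x α := by
  have h1 := IsKilling.finrank_rootSpace_eq_one α (by simpa using hα)
  have h2 := (finrank_eq_one_iff_of_nonzero' (⟨D.x α, D.x_mem α hα⟩ : rootSpace H α) (by
    simpa using D.x_ne_zero hα)).mp h1 ⟨y, hy⟩
  obtain ⟨c, hc⟩ := h2
  exact ⟨c, by simpa using congrArg Subtype.val hc.symm⟩

open Classical in
lemma form_x_x {α β : Weight ℂ H g} (hα : α ∈ H.root) (hβ : β ∈ H.root) :
    B.form (D.x β) (D.x (-α)) = if α = β then 1 else 0 := by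
  split_ifs with h
  · rw [← h, D.x_pair α hα]
  · refine form_eq_zero_of_rootSpace (D.x_mem β hβ) (D.x_neg_mem hα) fun h0 => h ?_
    ext k
    have := congrFun h0 k
    simp only [Pi.add_apply, Pi.neg_apply, Pi.zero_apply] at this
    linear_combination -this

lemma form_cartan_x (h : H) {α : Weight ℂ H g} (hα : α ∈ H.root) :
    B.form h (D.x α) = 0 := by
  refine form_eq_zero_of_rootSpace (cartan_mem_rootSpace_zero h) (D.x_mem α hα) ?_
  rw [zero_add]
  have : α.IsNonZero := by simpa using hα
  exact this

lemma h_expand (k : H) : ∑ i, B.form k (D.h i) • D.h' i = k := by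
  have key : ∀ i, B.form.flip (D.h i) ∘ₗ H.toSubmodule.subtype = D.h'.coord i := fun i => by
    classical
    refine D.h'.ext fun j => ?_
    change B.form (D.h' j) (D.h i) = D.h'.repr (D.h' j) i
    rw [B.symm, D.dual]
    simp [Finsupp.single_apply, eq_comm]
  conv_rhs => rw [← D.h'.sum_repr k]
  exact Finset.sum_congr rfl fun i _ => congrArg (· • D.h' i) (LinearMap.congr_fun (key i) k)

lemma h_expand' (k : H) : ∑ i, B.form k (D.h' i) • D.h i = k := by
  have key : ∀ i, B.form.flip (D.h' i) ∘ₗ H.toSubmodule.subtype = D.h.coord i := fun i => by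
    classical
    refine D.h.ext fun j => ?_
    change B.form (D.h j) (D.h' i) = D.h.repr (D.h j) i
    rw [D.dual]
    simp [Finsupp.single_apply]
  conv_rhs => rw [← D.h.sum_repr k]
  exact Finset.sum_congr rfl fun i _ => congrArg (· • D.h i) (LinearMap.congr_fun (key i) k)

lemma isDualFamily : IsDualFamily B D.fam D.fam' where
  expand y := by
    classical
    have key : ∑ i, (B.form.flip (D.fam i)).smulRight (D.fam' i) - LinearMap.id = 0 := by
      refine linearMap_eq_zero_of_rootSpace (H := H) _ (fun k => ?_) fun α hα y hy => ?_
      · have h1 := congrArg (Subtype.val) (D.h_expand k)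
        simp only [AddSubmonoidClass.coe_finsetSum] at h1
        simpa [fam, fam', D.form_cartan_x k (neg_mem_root _), sub_eq_zero] using h1
      · obtain ⟨c, rfl⟩ := D.exists_smul_x hα hy
        have h1 : ∀ i, B.form (D.x α) (D.h i : g) = 0 := fun i => by
          rw [B.symm, D.form_cartan_x _ hα]
        have h2 : ∀ β : H.root, B.form (D.x α) (D.x (-(β : Weight ℂ H g))) =
            if β = ⟨α, hα⟩ then 1 else 0 := fun β => by
          rw [D.form_x_x β.2 hα]
          simp [Subtype.ext_iff]
        simp [fam, fam', h1, h2]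
    have := LinearMap.congr_fun key y
    simpa [sub_eq_zero] using this
  expand' y := by
    classical
    have key : ∑ i, (B.form.flip (D.fam' i)).smulRight (D.fam i) - LinearMap.id = 0 := by
      refine linearMap_eq_zero_of_rootSpace (H := H) _ (fun k => ?_) fun α hα y hy => ?_
      · have h1 := congrArg (Subtype.val) (D.h_expand' k)
        simp only [AddSubmonoidClass.coe_finsetSum] at h1
        simpa [fam, fam', D.form_cartan_x k, sub_eq_zero] using h1
      · obtain ⟨c, rfl⟩ := D.exists_smul_x hα hy
        have h1 : ∀ i, B.form (D.x α) (D.h' i : g) = 0 := fun i => by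
          rw [B.symm, D.form_cartan_x _ hα]
        -- The member of `fam` attached to β is `x (-β)`, so the surviving index β = -α returns `x
        -- α`.
        have h2 : ∀ β : H.root, B.form (D.x α) (D.x (β : Weight ℂ H g)) =
            if β = ⟨-α, neg_mem_root hα⟩ then 1 else 0 := fun β => by
          have := D.form_x_x (neg_mem_root β.2) hα
          rw [neg_neg] at this
          rw [this]
          simp [Subtype.ext_iff, neg_eq_iff_eq_neg]
        simp [fam, fam', h1, h2]
    have := LinearMap.congr_fun key y
    simpa [sub_eq_zero] using this

/-- The element `[x_α, x_{-α}]` of the Cartan subalgebra. -/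
def t (α : Weight ℂ H g) : H :=
  killingForm ℂ g (D.x α) (D.x (-α)) • (IsKilling.cartanEquivDual H).symm α

lemma lie_x_x {α : Weight ℂ H g} (hα : α ∈ H.root) :
    ⁅D.x α, D.x (-α)⁆ = (D.t α : g) := by
  rw [IsKilling.lie_eq_killingForm_smul_of_mem_rootSpace_of_mem_rootSpace_neg
    (D.x_mem α hα) (D.x_neg_mem hα)]
  rfl

lemma lie_cartan_x (k : H) {α : Weight ℂ H g} (hα : α ∈ H.root) :
    ⁅(k : g), D.x α⁆ = α k • D.x α :=
  IsKilling.lie_eq_smul_of_mem_rootSpace (D.x_mem α hα) k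

/-- By invariance and `(x_α, x_{-α}) = 1`, the vector `t α`, although written with the Killing form,
represents α for the form `B`. -/
lemma form_t {α : Weight ℂ H g} (hα : α ∈ H.root) (k : H) : B.form (D.t α) k = α k := by
  rw [← D.lie_x_x hα, B.invariant, ← lie_skew, D.lie_cartan_x k (neg_mem_root hα)]
  simp [D.x_pair α hα]

lemma apply_t_symm {α β : Weight ℂ H g} (hα : α ∈ H.root) (hβ : β ∈ H.root) :
    β (D.t α) = α (D.t β) := by
  rw [← D.form_t hα, ← D.form_t hβ, B.symm]

/-- Both vectors are multiples of the Killing dual of α. This is the passage from the form to the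
root pairing. -/
lemma t_eq_smul_coroot {α : Weight ℂ H g} (hα : α ∈ H.root) :
    D.t α = (α (D.t α) / 2) • IsKilling.coroot α := by
  have h0 := IsKilling.root_apply_cartanEquivDual_symm_ne_zero (α := α) (by simpa using hα)
  have h1 : ∀ (c : ℂ) (k : H), α (c • k) = c * α k := fun c k => by
    exact map_smul (Weight.toLinear ℂ H g α) c k
  rw [IsKilling.coroot, t, h1, ← Nat.cast_smul_eq_nsmul ℂ, smul_smul, smul_smul]
  congr 1
  field_simp
  push_cast
  ring

end CasimirData

end RootData

/-! ### Positive roots and the highest root. -/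

section PositiveRoots

variable {g : Type*} [LieRing g] [LieAlgebra ℂ g] [FiniteDimensional ℂ g] [LieAlgebra.IsSimple ℂ g]
variable {H : LieSubalgebra ℂ g} [H.IsCartanSubalgebra]
variable (b : (IsKilling.rootSystem H).Base)

lemma mem_closure_simple_iff {x : Module.Dual ℂ H} :
    x ∈ AddSubmonoid.closure ((IsKilling.rootSystem H).root '' b.support) ↔
      ∃ c : b.support → ℕ, ∑ i, c i • (IsKilling.rootSystem H).root i = x := by
  rw [← Submodule.span_nat_eq_addSubmonoidClosure, Submodule.mem_toAddSubmonoid,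
    Fintype.mem_span_image_iff_exists_fun]
  rfl

lemma isPos_of_mem_closure {α : H.root} (hα : (IsKilling.rootSystem H).root α ∈
    AddSubmonoid.closure ((IsKilling.rootSystem H).root '' b.support)) : b.IsPos α := by
  classical
  obtain ⟨c, hc⟩ := (mem_closure_simple_iff b).mp hα
  rw [RootPairing.Base.isPos_iff']
  have h1 : (IsKilling.rootSystem H).root α =
      ∑ i ∈ b.support, (fun i => if h : i ∈ b.support then (c ⟨i, h⟩ : ℤ) else 0) i •
        (IsKilling.rootSystem H).root i := by
    rw [← hc, ← Finset.sum_coe_sort b.support]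
    refine Finset.sum_congr rfl fun i _ => ?_
    simp only [i.2, dif_pos, natCast_zsmul]
  rw [b.height_eq_sum h1]
  refine Finset.sum_nonneg fun i _ => ?_
  split_ifs
  positivity

lemma eq_zero_of_mem_closure_of_neg_mem_closure {x : Module.Dual ℂ H}
    (h1 : x ∈ AddSubmonoid.closure ((IsKilling.rootSystem H).root '' b.support))
    (h2 : -x ∈ AddSubmonoid.closure ((IsKilling.rootSystem H).root '' b.support)) : x = 0 := by
  obtain ⟨c, hc⟩ := (mem_closure_simple_iff b).mp h1
  obtain ⟨c', hc'⟩ := (mem_closure_simple_iff b).mp h2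
  have h3 : ∑ i : b.support, ((c i : ℂ) + c' i) • (IsKilling.rootSystem H).root i = 0 := by
    simp_rw [add_smul, Finset.sum_add_distrib, Nat.cast_smul_eq_nsmul, hc, hc']
    simp
  have h4 := Fintype.linearIndependent_iff.mp b.linearIndepOn_root _ h3
  rw [← hc]
  refine Finset.sum_eq_zero fun i _ => ?_
  have h5 : c i + c' i = 0 := by exact_mod_cast h4 i
  rw [(Nat.add_eq_zero_iff.mp h5).1, zero_smul]

lemma not_isPos_of_root_eq_neg {α β : H.root}
    (h : (IsKilling.rootSystem H).root β = -(IsKilling.rootSystem H).root α)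
    (hα : b.IsPos α) : ¬ b.IsPos β := by
  -- Since -α = α + (-2)α, the heights of α and -α are opposite.
  have h1 := b.height_add_zsmul (i := α) (j := α) (k := β) (z := -2) (by rw [h]; module)
  rw [RootPairing.Base.isPos_iff] at hα ⊢
  simp only [smul_eq_mul] at h1
  omega

lemma exists_neg_root (α : H.root) : ∃ β : H.root, (β : Weight ℂ H g) = -(α : Weight ℂ H g) ∧
    (IsKilling.rootSystem H).root β = -(IsKilling.rootSystem H).root α :=
  ⟨⟨-(α : Weight ℂ H g), CasimirData.neg_mem_root α.2⟩, rfl, rfl⟩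

section Highest

variable {b} {θ : H.root} (hθ : IsHighestRoot b θ)
include hθ

/-- Otherwise -θ is a nonnegative combination of simple roots, hence so is -2θ; but 2θ = θ - (-θ) is
one too, forcing θ = 0. -/
lemma IsHighestRoot.mem_closure : (IsKilling.rootSystem H).root θ ∈
    AddSubmonoid.closure ((IsKilling.rootSystem H).root '' b.support) := by
  refine (b.root_mem_or_neg_mem θ).resolve_right fun h => ?_
  obtain ⟨β, -, hβ⟩ := exists_neg_root θ
  have h1 := hθ β
  rw [hβ, sub_neg_eq_add] at h1
  have h2 := eq_zero_of_mem_closure_of_neg_mem_closure b h1 (by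
    rw [neg_add]
    exact add_mem h h)
  rw [← two_smul ℂ] at h2
  exact (IsKilling.rootSystem H).ne_zero θ ((smul_eq_zero.mp h2).resolve_left two_ne_zero)

/-- Maximality of θ is applied to -α. This makes α + δ = α₀ + (θ + α) a nonnegative combination of
affine simple roots. -/
lemma IsHighestRoot.add_mem_closure (α : H.root) :
    (IsKilling.rootSystem H).root θ + (IsKilling.rootSystem H).root α ∈
      AddSubmonoid.closure ((IsKilling.rootSystem H).root '' b.support) := by
  obtain ⟨β, -, hβ⟩ := exists_neg_root α
  simpa [hβ] using hθ β

end Highest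

open Classical in
/-- The sum of the positive roots pairs to `2` with each simple coroot. -/
lemma sum_isPos_pairing {i : H.root} (hi : i ∈ b.support) :
    ∑ α : H.root with b.IsPos α, (IsKilling.rootSystem H).pairing α i = 2 := by
  have hmem : i ∈ Finset.univ.filter fun α : H.root => b.IsPos α := by
    simpa using RootPairing.Base.isPos_of_mem_support hi
  rw [← Finset.add_sum_erase _ _ hmem, RootPairing.pairing_same]
  -- The reflection in the simple root permutes the remaining positive roots and negates the
  -- pairing, so their terms cancel.
  suffices ∑ α ∈ (Finset.univ.filter fun α : H.root => b.IsPos α).erase i,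
      (IsKilling.rootSystem H).pairing α i = 0 by rw [this, add_zero]
  have hneg : ∀ α : H.root,
      (IsKilling.rootSystem H).pairing ((IsKilling.rootSystem H).reflectionPerm i α) i =
        -(IsKilling.rootSystem H).pairing α i := fun α => by
    rw [← RootPairing.pairing_reflectionPerm, RootPairing.pairing_reflectionPerm_self_right]
  refine Finset.sum_involution (fun α _ => (IsKilling.rootSystem H).reflectionPerm i α)
    (fun α _ => ?_) (fun α _ h0 heq => h0 ?_) (fun α hα => ?_) (fun α _ => ?_)
  · rw [hneg, add_neg_cancel]
  · have h1 := hneg α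
    rw [heq] at h1
    exact self_eq_neg.mp h1
  · simp only [Finset.mem_erase, Finset.mem_filter, Finset.mem_univ, true_and] at hα ⊢
    refine ⟨fun h => ?_, hα.2.reflectionPerm hi hα.1⟩
    have h1 := (IsKilling.rootSystem H).root_reflectionPerm i α
    rw [h] at h1
    have h2 := congrArg ((IsKilling.rootSystem H).reflection i) h1
    rw [RootPairing.reflection_same, RootPairing.reflection_apply_self] at h2
    exact not_isPos_of_root_eq_neg b h2.symm (RootPairing.Base.isPos_of_mem_support hi) hα.2
  · exact RootPairing.reflectionPerm_self _ _ _

open Classical in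
lemma sum_root_eq_sum_isPos {M : Type*} [AddCommMonoid M] (F : Weight ℂ H g → M) :
    ∑ α : H.root, F α = ∑ α : H.root with b.IsPos α, (F α + F (-(α : Weight ℂ H g))) := by
  rw [Finset.sum_add_distrib, ← Finset.sum_filter_add_sum_filter_not _ fun α : H.root => b.IsPos α]
  congr 1
  let N : H.root ≃ H.root := Function.Involutive.toPerm
    (fun α => ⟨-(α : Weight ℂ H g), CasimirData.neg_mem_root α.2⟩) fun α => by simp
  refine Finset.sum_equiv N (fun α => ?_) fun α _ => ?_
  · have h1 : (IsKilling.rootSystem H).root (N α) = -(IsKilling.rootSystem H).root α := rfl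
    simp only [Finset.mem_filter, Finset.mem_univ, true_and]
    refine ⟨fun hα => ?_, fun hα hα' => not_isPos_of_root_eq_neg b h1 hα' hα⟩
    have h2 := b.height_add_zsmul (i := α) (j := α) (k := N α) (z := -2) (by rw [h1]; module)
    rw [RootPairing.Base.isPos_iff'] at hα ⊢
    simp only [smul_eq_mul] at h2
    omega
  · change F α = F (- -(α : Weight ℂ H g))
    rw [neg_neg]

end PositiveRoots

/-! ### The vector ρ and the Casimir eigenvalue. -/

section Rho

variable {g : Type*} [LieRing g] [LieAlgebra ℂ g] [FiniteDimensional ℂ g] [LieAlgebra.IsSimple ℂ g]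
variable {B : InvariantForm g} {H : LieSubalgebra ℂ g} [H.IsCartanSubalgebra]

omit [FiniteDimensional ℂ g] [LieAlgebra.IsSimple ℂ g] [H.IsCartanSubalgebra] in
lemma gammaMap_symm (s s' : AffCartan H) : gammaMap B H s s' = gammaMap B H s' s := by
  simp only [gammaMap, LinearMap.mk₂_apply]
  rw [B.symm]
  ring

lemma gamma_apply (s : AffCartan H) : gamma B H s = gammaMap B H s := rfl

lemma dualForm_eq_apply (μ ν : Module.Dual ℂ (AffCartan H)) :
    dualForm B H μ ν = ν ((gamma B H).symm μ) := by
  rw [dualForm, gammaMap_symm, ← gamma_apply, LinearEquiv.apply_symm_apply]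

namespace CasimirData

variable {b : (IsKilling.rootSystem H).Base} {θ : H.root} (D : CasimirData B b θ)

/-- Since (K, d) = 1 and K is orthogonal to h and itself, γ sends K to δ; hence n sits in the
K-slot. -/
lemma gamma_symm_affineWeight {α : Module.Dual ℂ H} {t : H}
    (ht : ∀ k : H, B.form t k = α k) (n : ℤ) :
    (gamma B H).symm (affineWeight α n) = (t, (n : ℂ), 0) := by
  rw [LinearEquiv.symm_apply_eq, gamma_apply]
  refine LinearMap.ext fun s => ?_
  simp [affineWeight, gammaMap, ht]

lemma root_rho {i : H.root} (hi : i ∈ b.support) :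
    (i : Weight ℂ H g) ((gamma B H).symm D.ρ).1 = (i : Weight ℂ H g) (D.t i) / 2 := by
  have h1 := D.rho_spec (some ⟨i, hi⟩)
  rw [dualForm_eq_apply, dualForm_eq_apply] at h1
  simp only [affineSimpleRoot] at h1
  rw [gamma_symm_affineWeight (t := D.t i) (fun k => by rw [D.form_t i.2]; simp)] at h1
  simpa [affineWeight] using h1

/-- This is the condition on ρ at α₀ = -θ + δ: (ρ, δ) is the d-coefficient of `γ⁻¹(ρ)`, and (α₀, α₀)
= (θ, θ) because δ is isotropic and orthogonal to θ. -/
lemma d_coeff_rho :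
    ((gamma B H).symm D.ρ).2.2 = (θ : Weight ℂ H g) ((gamma B H).symm D.ρ).1 +
      (θ : Weight ℂ H g) (D.t θ) / 2 := by
  have h1 := D.rho_spec none
  rw [dualForm_eq_apply, dualForm_eq_apply] at h1
  simp only [affineSimpleRoot] at h1
  rw [gamma_symm_affineWeight (t := -D.t θ) (fun k => by
    have := D.form_t θ.2 k
    simp [this])] at h1
  simp only [affineWeight] at h1
  have h2 : ((gamma B H).symm D.ρ).2.2 - (θ : Weight ℂ H g) ((gamma B H).symm D.ρ).1 =
      (θ : Weight ℂ H g) (D.t θ) / 2 := by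
    simpa [neg_add_eq_sub] using h1
  rw [← h2]
  ring

-- The simple roots span the dual of h, and each αᵢ takes the value (αᵢ, αᵢ) on both sides, by
-- `sum_isPos_pairing` and the condition on ρ.
open Classical in
lemma sum_isPos_t : ∑ α : H.root with b.IsPos α, D.t α = (2 : ℂ) • ((gamma B H).symm D.ρ).1 := by
  rw [← sub_eq_zero, ← Module.forall_dual_apply_eq_zero_iff ℂ]
  intro f
  have hf : f ∈ Submodule.span ℂ ((IsKilling.rootSystem H).root '' b.support) := by
    rw [b.span_root_support, RootPairing.rootSpan, RootPairing.IsRootSystem.span_root_eq_top]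
    trivial
  induction hf using Submodule.span_induction with
  | zero => simp
  | add a c _ _ ha hc => rw [LinearMap.add_apply, ha, hc, add_zero]
  | smul c a _ ha => rw [LinearMap.smul_apply, ha, smul_zero]
  | mem a ha =>
    obtain ⟨i, hi, rfl⟩ := ha
    have h1 : ∀ α : H.root, (i : Weight ℂ H g) (D.t α) =
        (i : Weight ℂ H g) (D.t i) / 2 * (IsKilling.rootSystem H).pairing α i := fun α => by
      rw [D.apply_t_symm α.2 i.2]
      conv_lhs => rw [D.t_eq_smul_coroot i.2]
      exact map_smul (Weight.toLinear ℂ H g α) _ (IsKilling.coroot (i : Weight ℂ H g))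
    have h2 : ∑ α : H.root with b.IsPos α, (i : Weight ℂ H g) (D.t α) =
        (i : Weight ℂ H g) (D.t i) := by
      rw [Finset.sum_congr rfl fun α _ => h1 α, ← Finset.mul_sum, sum_isPos_pairing b hi]
      ring
    rw [map_sub, map_sum, map_smul]
    change ∑ α : H.root with b.IsPos α, (i : Weight ℂ H g) (D.t α) -
      (2 : ℂ) • (i : Weight ℂ H g) ((gamma B H).symm D.ρ).1 = 0
    rw [h2, D.root_rho hi, smul_eq_mul]
    ring

lemma t_expand {α : Weight ℂ H g} (hα : α ∈ H.root) :
    ∑ i, α (D.h i) * α (D.h' i) = α (D.t α) := by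
  conv_rhs => rw [← D.h_expand (D.t α)]
  have := map_sum (Weight.toLinear ℂ H g α)
    (fun i => B.form (D.t α) (D.h i) • D.h' i) Finset.univ
  simp only [Weight.toLinear_apply, map_smul, smul_eq_mul] at this
  rw [this]
  simp_rw [D.form_t hα]

/-- No positive root can be added to the highest root. -/
lemma lie_x_highest (hθ : IsHighestRoot b θ) {α : H.root} (hα : b.IsPos α) :
    ⁅D.x α, D.x θ⁆ = 0 := by
  by_contra h0
  have h1 : ⁅D.x α, D.x θ⁆ ∈ rootSpace H ((α : Weight ℂ H g) + (θ : Weight ℂ H g) : H → ℂ) :=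
    lie_mem_genWeightSpace_of_mem_genWeightSpace (D.x_mem α α.2) (D.x_mem θ θ.2)
  have h2 : b.IsPos θ := isPos_of_mem_closure b hθ.mem_closure
  let ω : Weight ℂ H g := ⟨(α : Weight ℂ H g) + (θ : Weight ℂ H g),
    fun h => h0 ((LieSubmodule.mem_bot _).mp (le_of_eq h h1))⟩
  have hω : (ω : H → ℂ) = (α : Weight ℂ H g) + (θ : Weight ℂ H g) := rfl
  by_cases hz : ω.IsZero
  · refine not_isPos_of_root_eq_neg b (α := θ) (β := α) ?_ h2 hα
    have hz' : (ω : H → ℂ) = 0 := hz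
    ext k
    have := congrFun (hω.symm.trans hz') k
    simp only [Pi.add_apply, Pi.zero_apply] at this
    simpa [eq_neg_iff_add_eq_zero] using this
  · have h3 := hθ ⟨ω, by simpa using hz⟩
    -- If α + θ were a root, maximality of θ would make -α positive.
    have h4 : (IsKilling.rootSystem H).root θ -
        (IsKilling.rootSystem H).root ⟨ω, by simpa using hz⟩ =
        -(IsKilling.rootSystem H).root α := by
      ext k
      have := congrFun hω k
      simp [this]
    obtain ⟨β, -, hβ⟩ := exists_neg_root α
    rw [h4, ← hβ] at h3
    exact not_isPos_of_root_eq_neg b hβ hα (isPos_of_mem_closure b h3)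

/-- As `x_θ` is killed by positive root vectors, each pair ±α contributes θ(t α). Adding the Cartan
part (θ,θ) gives (θ,θ) + 2(ρ,θ), which `d_coeff_rho` evaluates. -/
lemma casimir_highest (hθ : IsHighestRoot b θ) :
    IsDualFamily.casimir D.fam D.fam' (D.x θ) =
      (2 * ((gamma B H).symm D.ρ).2.2) • D.x θ := by
  classical
  rw [IsDualFamily.casimir_apply, Fintype.sum_sum_type]
  have h1 : ∀ i, ⁅(D.h i : g), ⁅(D.h' i : g), D.x θ⁆⁆ =
      ((θ : Weight ℂ H g) (D.h i) * (θ : Weight ℂ H g) (D.h' i)) • D.x θ := fun i => by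
    rw [D.lie_cartan_x _ θ.2, lie_smul, D.lie_cartan_x _ θ.2, smul_smul, mul_comm]
  simp only [fam, fam', Sum.elim_inl, Sum.elim_inr, h1]
  rw [← Finset.sum_smul, D.t_expand θ.2,
    sum_root_eq_sum_isPos b fun α => ⁅D.x (-α), ⁅D.x α, D.x θ⁆⁆]
  have h2 : ∀ α ∈ Finset.univ.filter fun α : H.root => b.IsPos α,
      ⁅D.x (-(α : Weight ℂ H g)), ⁅D.x α, D.x θ⁆⁆ +
      ⁅D.x (-(-(α : Weight ℂ H g))), ⁅D.x (-(α : Weight ℂ H g)), D.x θ⁆⁆ =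
      (θ : Weight ℂ H g) (D.t α) • D.x θ := fun α hα => by
    have hp : ⁅D.x α, D.x θ⁆ = 0 := D.lie_x_highest hθ (by simpa using hα)
    rw [hp, lie_zero, zero_add, neg_neg, leibniz_lie, hp, lie_zero, add_zero, D.lie_x_x α.2,
      D.lie_cartan_x _ θ.2]
  rw [Finset.sum_congr rfl h2, ← Finset.sum_smul, ← add_smul, D.d_coeff_rho]
  congr 1
  have h3 := congrArg (Weight.toLinear ℂ H g θ) D.sum_isPos_t
  rw [map_sum, map_smul] at h3
  simp only [Weight.toLinear_apply, smul_eq_mul] at h3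
  rw [h3]
  ring

/-- The eigenspace of the Casimir through `x_θ` is a nonzero ideal, hence everything by simplicity.
-/
lemma casimir_eq (hθ : IsHighestRoot b θ) (y : g) :
    IsDualFamily.casimir D.fam D.fam' y = (2 * ((gamma B H).symm D.ρ).2.2) • y := by
  set c := 2 * ((gamma B H).symm D.ρ).2.2
  let I : LieIdeal ℂ g :=
    { LinearMap.ker (IsDualFamily.casimir D.fam D.fam' - c • LinearMap.id) with
      lie_mem := fun {z m} hm => by
        have hm' : IsDualFamily.casimir D.fam D.fam' m - c • m = 0 := by simpa using hm
        simp [D.isDualFamily.casimir_lie, ← lie_smul, ← lie_sub, hm'] }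
  have hI : D.x θ ∈ I := by
    change D.x θ ∈ LinearMap.ker (IsDualFamily.casimir D.fam D.fam' - c • LinearMap.id)
    simp [D.casimir_highest hθ, c]
  have htop : I = ⊤ := (LieAlgebra.IsSimple.eq_bot_or_eq_top I).resolve_left fun h => by
    rw [h] at hI
    exact D.x_ne_zero θ.2 (by simpa using hI)
  have hy : y ∈ I := htop ▸ LieSubmodule.mem_top y
  have hy' : y ∈ LinearMap.ker (IsDualFamily.casimir D.fam D.fam' - c • LinearMap.id) := hy
  simpa [sub_eq_zero] using hy'

end CasimirData

end Rho

/-! ### The telescoping identity. -/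

section Telescoping

/-- A finite telescoping identity for two sequences indexed by `ℤ` which vanish for large indices
and are reflections of each other up to a constant. -/
lemma sum_sub_shift_add {M : Type*} [AddCommGroup M] (f f' : ℤ → M) (w : M) (m : ℤ) (N₀ : ℕ)
    (hf : ∀ n : ℤ, N₀ ≤ n → f n = 0) (hf' : ∀ n : ℤ, N₀ ≤ n → f' n = 0)
    (hrel : m ≠ 0 → ∀ k, f k + f' (m - k) = w) (N : ℕ) (hN : N₀ + |m| ≤ N) :
    ∑ n ∈ Finset.range N, (f (n + 1) - f (n + 1 + m)) +
      ∑ n ∈ Finset.range N, (f' (n + 1) - f' (n + 1 + m)) + (f 0 - f m) = m • w := by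
  -- A discrete primitive: F(k) is the sum of f(n) over n > k, finite because f vanishes from N₀ on.
  have hprim : ∀ f : ℤ → M, (∀ n : ℤ, N₀ ≤ n → f n = 0) → ∃ F : ℤ → M,
      (∀ k, F k - F (k + 1) = f (k + 1)) ∧ ∀ k : ℤ, N₀ ≤ k → F k = 0 := fun f hf => by
    refine ⟨fun k => ∑ n ∈ Finset.Ioc k N₀, f n, fun k => ?_, fun k hk => by simp [hk]⟩
    by_cases hk : k < N₀
    · have : Finset.Ioc k (N₀ : ℤ) = insert (k + 1) (Finset.Ioc (k + 1) N₀) := by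
        ext n
        simp only [Finset.mem_Ioc, Finset.mem_insert]
        omega
      simp [this]
    · dsimp only
      rw [hf (k + 1) (by omega), Finset.Ioc_eq_empty (by omega), Finset.Ioc_eq_empty (by omega),
        sub_self]
  obtain ⟨F, hF, hF0⟩ := hprim f hf
  obtain ⟨F', hF', hF0'⟩ := hprim f' hf'
  have hsum : ∀ (f F : ℤ → M), (∀ k, F k - F (k + 1) = f (k + 1)) →
      (∀ k : ℤ, N₀ ≤ k → F k = 0) →
      ∑ n ∈ Finset.range N, (f (n + 1) - f (n + 1 + m)) = F 0 - F m := fun f F hF hF0 => by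
    have hm := abs_le.mp (le_refl |m|)
    have h1 := Finset.sum_range_sub' (fun n : ℕ => F n) N
    have h2 := Finset.sum_range_sub' (fun n : ℕ => F (n + m)) N
    rw [Finset.sum_sub_distrib]
    have e1 : ∀ n : ℕ, f (n + 1) = F n - F ((n + 1 : ℕ) : ℤ) := fun n => by
      rw [← hF]; push_cast; rfl
    have e2 : ∀ n : ℕ, f (n + 1 + m) = F (n + m) - F (((n + 1 : ℕ) : ℤ) + m) := fun n => by
      rw [show (n : ℤ) + 1 + m = (n + m) + 1 by ring, ← hF]; push_cast
      rw [show (n : ℤ) + 1 + m = (n + m) + 1 by ring]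
    simp_rw [e1, e2]
    rw [h1, h2, hF0 N (by omega), hF0 (N + m) (by omega)]
    simp
  rw [hsum f F hF hF0, hsum f' F' hF' hF0']
  -- For m = 0 both sides vanish, and no reflection relation is available.
  by_cases hm : m = 0
  · simp [hm]
  -- Raising k by one adds f(k) + f'(m - k) = w. At k = m the left side is the required sum, as
  -- F(-1) = F(0) + f(0) and F(m-1) = F(m) + f(m).
  have key : ∀ k : ℤ, F (-1) - F (k - 1) + (F' (m - k) - F' m) = k • w := fun k => by
    have step : ∀ k : ℤ, F (-1) - F (k + 1 - 1) + (F' (m - (k + 1)) - F' m) =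
        F (-1) - F (k - 1) + (F' (m - k) - F' m) + w := fun k => by
      have h1 := hF (k - 1)
      have h2 := hF' (m - (k + 1))
      rw [show k - 1 + 1 = k by ring] at h1
      rw [show m - (k + 1) + 1 = m - k by ring] at h2
      rw [← hrel hm k, ← h1, ← h2, show k + 1 - 1 = k by ring]
      abel
    induction k using Int.induction_on with
    | zero => simp
    | succ k ih => rw [step, ih, add_smul, one_smul]
    | pred k ih =>
      have h1 := step (-(k : ℤ) - 1)
      rw [show -(k : ℤ) - 1 + 1 = -k by ring, ih] at h1
      rw [sub_smul, one_smul, h1]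
      abel
  have h1 := hF (-1)
  have h2 := hF (m - 1)
  have h3 := key m
  rw [show m - 1 + 1 = m by ring] at h2
  rw [show (-1 : ℤ) + 1 = 0 by ring] at h1
  rw [sub_self] at h3
  rw [← h3, ← h1, ← h2]
  abel

end Telescoping

/-! ### Commutators of modes. -/

section Action

variable {g : Type*} [LieRing g] [LieAlgebra ℂ g]
variable {A : Type*} [CommRing A] [Algebra ℂ A] {B : InvariantForm g}
variable {V : Type*} [AddCommGroup V] [Module ℂ V] [LieRingModule (A ⊗[ℂ] Tau B) V]
  [LieModule ℂ (A ⊗[ℂ] Tau B) V]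

lemma act_add (u v : Tau B) (a : A) : (act (u + v) a : Module.End ℂ V) = act u a + act v a := by
  simp [act, TensorProduct.tmul_add]

lemma act_smul (c : ℂ) (u : Tau B) (a : A) : (act (c • u) a : Module.End ℂ V) = c • act u a := by
  simp [act, TensorProduct.tmul_smul]

lemma act_zero (a : A) : (act (0 : Tau B) a : Module.End ℂ V) = 0 := by
  simp [act]

lemma act_neg (u : Tau B) (a : A) : (act (-u) a : Module.End ℂ V) = -act u a := by
  simp [act, TensorProduct.tmul_neg]

lemma act_mul_act (u v : Tau B) (a a' : A) :
    (act u a * act v a' : Module.End ℂ V) = act v a' * act u a + act ⁅u, v⁆ (a * a') := by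
  have h1 : ((a * a') ⊗ₜ[ℂ] ⁅u, v⁆ : A ⊗[ℂ] Tau B) = ⁅a ⊗ₜ[ℂ] u, a' ⊗ₜ[ℂ] v⁆ := rfl
  ext v
  simp only [act, Module.End.mul_apply, LinearMap.add_apply, LieModule.toEnd_apply_apply, h1]
  rw [lie_lie]
  abel

variable (V) in
/-- The operators `x(n)(a)`, as a linear map in `x`. -/
def actX (n : ℤ) (a : A) : g →ₗ[ℂ] Module.End ℂ V where
  toFun x := act (Tau.X B n x) a
  map_add' x y := by rw [map_add, act_add]
  map_smul' c x := by rw [map_smul, act_smul]; rfl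

lemma actX_apply (n : ℤ) (a : A) (x : g) :
    actX (B := B) V n a x = act (Tau.X B n x) a := rfl

variable {ι : Type*} [Fintype ι] (u u' : ι → g)

variable (B V) in
/-- The operator `∑ᵢ uᵢ(p)(a) u'ᵢ(q)(a')`. -/
def pairSum (p q : ℤ) (a a' : A) : Module.End ℂ V :=
  ∑ i, act (Tau.X B p (u i)) a * act (Tau.X B q (u' i)) a'

variable (B V) in
/-- The operator `∑ᵢ [y, uᵢ](p)(a) u'ᵢ(q)(a')`. -/
def liePairSum (p q : ℤ) (a a' : A) (y : g) : Module.End ℂ V :=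
  ∑ i, act (Tau.X B p ⁅y, u i⁆) a * act (Tau.X B q (u' i)) a'

variable {u u'}

variable (V) in
lemma IsDualFamily.liePairSum_eq (h : IsDualFamily B u u') (p q : ℤ) (a a' : A) (y : g) :
    ∑ i, (act (Tau.X B p (u i)) a * act (Tau.X B q ⁅y, u' i⁆) a' : Module.End ℂ V) =
      -liePairSum B V u u' p q a a' y :=
  h.sum_lie ((LinearMap.mul ℂ (Module.End ℂ V)).compl₁₂ (actX V p a) (actX V q a')) y

/-- Interchanging the two factors in `∑ᵢ [y, uᵢ](p)(a) u'ᵢ(q)(a')`, for `p + q ≠ 0`. -/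
lemma IsDualFamily.liePairSum_swap (h : IsDualFamily B u u') {p q : ℤ} (hpq : p + q ≠ 0)
    (a a' : A) (y : g) :
    liePairSum B V u u' q p a a' y + liePairSum B V u u' p q a' a y =
      act (Tau.X B (p + q) (casimir u u' y)) (a * a') := by
  -- Reordering the factors costs `[[y,uᵢ],u'ᵢ](p+q)(aa')`, which sums to the Casimir; what remains
  -- is minus the first term, by `sum_swap` and invariance.
  have h1 : liePairSum B V u u' p q a' a y = ∑ i, (act (Tau.X B q (u' i)) a *
      act (Tau.X B p ⁅y, u i⁆) a' + act (Tau.X B (p + q) ⁅⁅y, u i⁆, u' i⁆) (a * a')) := by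
    refine Finset.sum_congr rfl fun i _ => ?_
    rw [act_mul_act, Tau.X_lie_X, if_neg hpq]
    simp [mul_comm]
  have h2 := h.sum_swap ((LinearMap.mul ℂ (Module.End ℂ V)).compl₁₂ (actX (B := B) V q a)
    (actX (B := B) V p a' ∘ₗ LieAlgebra.ad ℂ g y))
  simp only [LinearMap.compl₁₂_apply, LinearMap.mul_apply', actX_apply, LinearMap.comp_apply,
    LieAlgebra.ad_apply] at h2
  rw [h1, Finset.sum_add_distrib, ← h2, h.liePairSum_eq V, h.casimir_apply',
    ← actX_apply (p + q), map_sum]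
  simp only [actX_apply]
  abel

/-- The commutator of `y(m)` with `∑ᵢ uᵢ(-n)(a) u'ᵢ(n)(a')`. -/
lemma IsDualFamily.act_mul_pairSum (h : IsDualFamily B u u') (m n : ℤ) (a a' : A) (y : g) :
    act (Tau.X B m y) (1 : A) * pairSum B V u u' (-n) n a a' =
      pairSum B V u u' (-n) n a a' * act (Tau.X B m y) (1 : A) +
      (liePairSum B V u u' (m - n) n a a' y - liePairSum B V u u' (m - (n + m)) (n + m) a a' y) +
      ((if m = n then (m : ℂ) • (act (Tau.K B) a * act (Tau.X B m y) a') else 0) +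
        if m = -n then (m : ℂ) • (act (Tau.K B) a' * act (Tau.X B m y) a) else 0) := by
  have hK : ∀ (c d : A) (z : Tau B),
      (act (Tau.K B) c * act z d : Module.End ℂ V) = act z d * act (Tau.K B) c := fun c d z => by
    rw [act_mul_act, Tau.K_lie, act_zero, add_zero]
  -- The pairings are kept inside the mode in the central terms, so that the sum over i rebuilds y
  -- from its expansions.
  have h1 : ∀ i, (act (Tau.X B m y) (1 : A) * (act (Tau.X B (-n) (u i)) a * act (Tau.X B n (u' i)) a') :
      Module.End ℂ V) = act (Tau.X B (-n) (u i)) a * act (Tau.X B n (u' i)) a' *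
        act (Tau.X B m y) (1 : A) + act (Tau.X B (m - n) ⁅y, u i⁆) a * act (Tau.X B n (u' i)) a' +
        act (Tau.X B (-n) (u i)) a * act (Tau.X B (n + m) ⁅y, u' i⁆) a' +
        ((if m = n then (m : ℂ) else 0) •
          (act (Tau.K B) a * act (Tau.X B m (B.form y (u i) • u' i)) a') +
        (if m = -n then (m : ℂ) else 0) •
          (act (Tau.K B) a' * act (Tau.X B m (B.form y (u' i) • u i)) a)) := fun i => by
    have c1 : (if m = n then (m : ℂ) else 0) •
          (act (Tau.K B) a * act (Tau.X B m (B.form y (u i) • u' i)) a' : Module.End ℂ V) =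
        ((if m = n then (m : ℂ) else 0) * B.form y (u i)) •
          (act (Tau.K B) a * act (Tau.X B n (u' i)) a') := by
      split_ifs with hmn
      · rw [hmn, map_smul, act_smul, mul_smul_comm, smul_smul]
      · simp
    have c2 : (if m = -n then (m : ℂ) else 0) •
          (act (Tau.K B) a' * act (Tau.X B m (B.form y (u' i) • u i)) a : Module.End ℂ V) =
        ((if m = -n then (m : ℂ) else 0) * B.form y (u' i)) •
          (act (Tau.X B (-n) (u i)) a * act (Tau.K B) a') := by
      split_ifs with hmn
      · rw [hmn, map_smul, act_smul, mul_smul_comm, smul_smul, hK]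
      · simp
    have e1 : (act (Tau.X B m y) (1 : A) * act (Tau.X B (-n) (u i)) a : Module.End ℂ V) =
        act (Tau.X B (-n) (u i)) a * act (Tau.X B m y) (1 : A) +
        (act (Tau.X B (m - n) ⁅y, u i⁆) a +
          ((if m = n then (m : ℂ) else 0) * B.form y (u i)) • act (Tau.K B) a) := by
      rw [act_mul_act, Tau.X_lie_X, act_add, act_smul, one_mul]
      simp only [← sub_eq_add_neg, sub_eq_zero]
    have e2 : (act (Tau.X B m y) (1 : A) * act (Tau.X B n (u' i)) a' : Module.End ℂ V) =
        act (Tau.X B n (u' i)) a' * act (Tau.X B m y) (1 : A) +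
        (act (Tau.X B (n + m) ⁅y, u' i⁆) a' +
          ((if m = -n then (m : ℂ) else 0) * B.form y (u' i)) • act (Tau.K B) a') := by
      rw [act_mul_act, Tau.X_lie_X, act_add, act_smul, one_mul, add_comm m n]
      simp only [show n + m = 0 ↔ m = -n by omega]
    rw [c1, c2, ← mul_assoc, e1, add_mul, mul_assoc, e2]
    simp only [mul_add, add_mul, smul_mul_assoc, mul_smul_comm, mul_assoc]
    abel
  rw [pairSum, Finset.mul_sum, Finset.sum_mul, Finset.sum_congr rfl fun i _ => h1 i]
  simp only [Finset.sum_add_distrib]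
  rw [h.liePairSum_eq V, ← liePairSum, ← Finset.smul_sum, ← Finset.smul_sum, ← Finset.mul_sum,
    ← Finset.mul_sum]
  simp only [← actX_apply, ← map_sum, h.expand, h.expand', ite_smul, zero_smul]
  rw [show m - (n + m) = -n by ring]
  abel

end Action

/-! ### Finite sums over positive integers. -/

lemma finsum_pnat_eq_sum_range {M : Type*} [AddCommMonoid M] (G : ℕ+ → M) {N : ℕ}
    (h : ∀ n : ℕ, N ≤ n → G n.succPNat = 0) :
    ∑ᶠ n, G n = ∑ n ∈ Finset.range N, G n.succPNat := by
  rw [← finsum_comp_equiv Equiv.pnatEquivNat.symm]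
  refine finsum_eq_sum_of_support_subset _ fun n hn => ?_
  by_contra hN
  exact hn (h n (by simpa using hN))

lemma finite_ne_zero_of_succPNat {M : Type*} [Zero M] (G : ℕ+ → M) {N : ℕ}
    (h : ∀ n : ℕ, N ≤ n → G n.succPNat = 0) : {n | G n ≠ 0}.Finite := by
  refine ((Finset.range N).finite_toSet.image Nat.succPNat).subset fun n hn => ?_
  refine ⟨n.natPred, ?_, PNat.succPNat_natPred n⟩
  by_contra hN
  exact hn (by simpa using h n.natPred (by simpa using hN))

lemma sum_range_ite_eq_add_one {M : Type*} [AddCommMonoid M] (m : ℤ) {N : ℕ} (hN : |m| ≤ N)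
    (z : M) : ∑ n ∈ Finset.range N, (if m = (n : ℤ) + 1 then z else 0) =
      if 0 < m then z else 0 := by
  have hm := abs_le.mp hN
  split_ifs with h
  · rw [Finset.sum_eq_single (m - 1).toNat]
    · rw [if_pos (by omega)]
    · intro n _ hn
      rw [if_neg (by omega)]
    · intro hn
      simp at hn
      omega
  · exact Finset.sum_eq_zero fun n _ => if_neg (by omega)

/-! ### Vanishing of high positive modes in category 𝒪. -/

section Vanishing

variable {g : Type*} [LieRing g] [LieAlgebra ℂ g] [FiniteDimensional ℂ g] [LieAlgebra.IsSimple ℂ g]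
variable {B : InvariantForm g} {H : LieSubalgebra ℂ g} [H.IsCartanSubalgebra]
variable {b : (IsKilling.rootSystem H).Base} {θ : H.root}

/-- The n copies of α₀ contribute nδ - nθ, and the term nθ in `hc` compensates. -/
lemma sum_affineSimpleRoot {α : Module.Dual ℂ H} {n : ℕ} {c : b.support → ℕ}
    (hc : ∑ i, c i • (IsKilling.rootSystem H).root i =
      n • (IsKilling.rootSystem H).root θ + α) :
    ∑ o : Option b.support, (o.elim n c) • affineSimpleRoot b θ o = affineWeight α n := by
  rw [Fintype.sum_option]
  have h1 : ∑ i : b.support, c i • affineSimpleRoot b θ (some i) =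
      (∑ i : b.support, c i • (IsKilling.rootSystem H).root i) ∘ₗ LinearMap.fst ℂ H (ℂ × ℂ) := by
    ext s <;> simp [affineSimpleRoot, affineWeight]
  simp only [Option.elim]
  rw [h1, hc]
  ext s <;> simp [affineSimpleRoot, affineWeight]

omit [LieAlgebra.IsSimple ℂ g] [H.IsCartanSubalgebra] [FiniteDimensional ℂ g] in
lemma X_mem_rootSubspace {α : Module.Dual ℂ H} {x : g} (hx : ∀ k : H, ⁅(k : g), x⁆ = α k • x)
    (n : ℤ) : Tau.X B n x ∈ rootSubspace B (affineWeight α n) := by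
  intro s
  have h1 : AffCartan.toTau B H s = Tau.X B 0 s.1 + (s.2.1 • Tau.K B + s.2.2 • Tau.L B 0) := rfl
  have h2 : affineWeight α n s = α s.1 + n * s.2.2 := by simp [affineWeight]
  rw [h1, h2, add_lie, add_lie, smul_lie, smul_lie, Tau.K_lie, Tau.L_lie_X, Tau.X_lie_X, hx,
    map_smul, zero_add, add_zero]
  simp
  module

variable {A : Type*} [CommRing A] [Algebra ℂ A]
variable {V : Type*} [AddCommGroup V] [Module ℂ V] [LieRingModule (A ⊗[ℂ] Tau B) V]
  [LieModule ℂ (A ⊗[ℂ] Tau B) V]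

/-- In category `𝒪`, each vector is killed by all `x(n)(a)` with `n` large. -/
lemma CategoryO.exists_act_X_eq_zero (hV : CategoryO A B V b θ) (hθ : IsHighestRoot b θ)
    (v : V) (a : A) : ∃ N : ℕ, ∀ n : ℤ, N ≤ n → ∀ x : g, act (Tau.X B n x) a v = 0 := by
  classical
  obtain ⟨N, hN⟩ := hV.locally_nilpotent v a
  -- The extra 1 forces n ≥ 1, so that nδ is a root and n - 1 below is an honest subtraction.
  refine ⟨N + 1, fun n hn x => ?_⟩
  lift n to ℕ using by omega
  obtain ⟨c, hc⟩ := (mem_closure_simple_iff b).mp hθ.mem_closure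
  have key : ∀ (α : Module.Dual ℂ H) (c' : b.support → ℕ) (z : g),
      (∑ i, c' i • (IsKilling.rootSystem H).root i = n • (IsKilling.rootSystem H).root θ + α) →
      IsAffineRoot (affineWeight α n) → (∀ k : H, ⁅(k : g), z⁆ = α k • z) →
      act (Tau.X B n z) a v = 0 := fun α c' z hc' hα hz => by
    -- The coefficient of α₀ is n, so the height is at least n.
    have h1 := hN (fun o => o.elim n c')
    rw [Fintype.sum_option] at h1
    simp only [sum_affineSimpleRoot hc'] at h1
    exact h1 (by simp only [Option.elim]; push_cast at hn; omega) hα _ (X_mem_rootSubspace hz n)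
  have h0 : LinearMap.flip (actX (B := B) V n a) v = 0 := by
    refine linearMap_eq_zero_of_rootSpace (H := H) _ (fun k => ?_) fun α hα y hy => ?_
    · refine key 0 (fun i => n * c i) k ?_ (Or.inr ⟨n, ?_, rfl⟩) fun k' => ?_
      · simp_rw [mul_smul]
        rw [← Finset.smul_sum, hc, add_zero]
      · push_cast at hn
        omega
      · have : ⁅k', k⁆ = 0 := trivial_lie_zero H H k' k
        simpa using congrArg (Subtype.val) this
    · obtain ⟨c', hc'⟩ := (mem_closure_simple_iff b).mp (hθ.add_mem_closure ⟨α, hα⟩)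
      -- The coefficients come from nθ + α = (n - 1)θ + (θ + α).
      refine key ((IsKilling.rootSystem H).root ⟨α, hα⟩) (fun i => (n - 1) * c i + c' i) y ?_
        (Or.inl ⟨α, hα, n, rfl⟩) fun k' => IsKilling.lie_eq_smul_of_mem_rootSpace hy k'
      simp_rw [add_smul, mul_smul]
      rw [Finset.sum_add_distrib, ← Finset.smul_sum, hc, hc', ← add_assoc, ← succ_nsmul]
      congr 3
      push_cast at hn
      omega
  exact LinearMap.congr_fun h0 x

end Vanishing

/-! ### Truncated Ω and its commutation with the modes y(m). -/

section Omega

variable {g : Type*} [LieRing g] [LieAlgebra ℂ g] [FiniteDimensional ℂ g] [LieAlgebra.IsSimple ℂ g]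
variable {B : InvariantForm g} {H : LieSubalgebra ℂ g} [H.IsCartanSubalgebra]
variable {b : (IsKilling.rootSystem H).Base} {θ : H.root} (D : CasimirData B b θ)
variable {A : Type*} [CommRing A] [Algebra ℂ A]
variable {V : Type*} [AddCommGroup V] [Module ℂ V] [LieRingModule (A ⊗[ℂ] Tau B) V]
  [LieModule ℂ (A ⊗[ℂ] Tau B) V]

variable (V) in
/-- The operator `Ω(a,a')` with the sums over `n > 0` truncated at `n = N`, and with the normally
ordered zero modes replaced by `∑ᵢ uᵢ(a) u'ᵢ(a')`. -/
def omegaTrunc (a a' : A) (N : ℕ) : Module.End ℂ V :=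
  pairSum B V D.fam D.fam' 0 0 a a' +
    (2 * ((gamma B H).symm D.ρ).2.1) • act (Tau.K B) (a * a') +
    (2 * ((gamma B H).symm D.ρ).2.2) • act (Tau.L B 0) (a * a') +
    act (Tau.K B) a * act (Tau.L B 0) a' + act (Tau.K B) a' * act (Tau.L B 0) a +
    ∑ n ∈ Finset.range N, (pairSum B V D.fam D.fam' (-((n : ℤ) + 1)) (n + 1) a a' +
      pairSum B V D.fam D.fam' (-((n : ℤ) + 1)) (n + 1) a' a)

lemma pairSum_fam_apply (p q : ℤ) (a a' : A) (v : V) :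
    pairSum B V D.fam D.fam' p q a a' v =
      ∑ α ∈ H.root, act (Tau.X B p (D.x (-α))) a (act (Tau.X B q (D.x α)) a' v) +
        ∑ i, act (Tau.X B p (D.h i : g)) a (act (Tau.X B q (D.h' i : g)) a' v) := by
  rw [pairSum, Fintype.sum_sum_type, LinearMap.add_apply, LinearMap.sum_apply,
    LinearMap.sum_apply, ← Finset.sum_coe_sort H.root]
  rfl

/-- Normal ordering of the zero modes produces the term `2 γ⁻¹(ρ)`. -/
lemma pairSum_fam_zero (a a' : A) (v : V) :
    pairSum B V D.fam D.fam' 0 0 a a' v =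
      (2 : ℂ) • act (Tau.X B 0 ((gamma B H).symm D.ρ).1) (a * a') v +
      ∑ i, act (Tau.X B 0 (D.h i : g)) a (act (Tau.X B 0 (D.h' i : g)) a' v) +
      omega3 D a a' v + omega3 D a' a v := by
  classical
  -- Only `x_α(a) x_{-α}(a')` with α > 0 is out of order; swapping its factors gives a term of
  -- `Ω³_{a',a}` plus `(t α)(aa')`.
  have h1 : ∀ α ∈ Finset.univ.filter fun α : H.root => b.IsPos α,
      act (Tau.X B 0 (D.x (-(α : Weight ℂ H g)))) a (act (Tau.X B 0 (D.x α)) a' v) +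
      act (Tau.X B 0 (D.x (- -(α : Weight ℂ H g)))) a
        (act (Tau.X B 0 (D.x (-(α : Weight ℂ H g)))) a' v) =
      act (Tau.X B 0 (D.x (-(α : Weight ℂ H g)))) a (act (Tau.X B 0 (D.x α)) a' v) +
      act (Tau.X B 0 (D.x (-(α : Weight ℂ H g)))) a' (act (Tau.X B 0 (D.x α)) a v) +
      LinearMap.flip (actX (B := B) V 0 (a * a')) v (D.t α) := fun α _ => by
    have h2 := LinearMap.congr_fun (act_mul_act (V := V) (Tau.X B 0 (D.x α))
      (Tau.X B 0 (D.x (-(α : Weight ℂ H g)))) a a') v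
    rw [Tau.X_lie_X, D.lie_x_x α.2] at h2
    simp only [add_zero, if_true, Int.cast_zero, zero_mul, zero_smul] at h2
    rw [neg_neg, add_assoc]
    exact congrArg _ h2
  have h3 := congrArg (fun k : H => LinearMap.flip (actX (B := B) V 0 (a * a')) v k) D.sum_isPos_t
  simp only [AddSubmonoidClass.coe_finsetSum, map_sum] at h3
  rw [pairSum_fam_apply, ← Finset.sum_coe_sort H.root, sum_root_eq_sum_isPos b
    fun α => act (Tau.X B 0 (D.x (-α))) a (act (Tau.X B 0 (D.x α)) a' v),
    Finset.sum_congr rfl h1, Finset.sum_add_distrib, Finset.sum_add_distrib, h3, omega3, omega3]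
  have h4 : LinearMap.flip (actX (B := B) V 0 (a * a')) v
      (((2 : ℂ) • ((gamma B H).symm D.ρ).1 : H) : g) =
      (2 : ℂ) • act (Tau.X B 0 ((gamma B H).symm D.ρ).1) (a * a') v :=
    map_smul (LinearMap.flip (actX (B := B) V 0 (a * a')) v) _ _
  rw [h4]
  abel

lemma omega1_add_omega2 (a a' : A) (v : V) {N : ℕ}
    (hN : ∀ n : ℤ, N ≤ n → ∀ x : g, act (Tau.X B n x) a' v = 0) :
    omega1 D a a' v + omega2 D a a' v = ∑ n ∈ Finset.range N,
      pairSum B V D.fam D.fam' (-((n : ℤ) + 1)) (n + 1) a a' v := by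
  have hcast : ∀ n : ℕ, ((n.succPNat : ℕ+) : ℤ) = (n : ℤ) + 1 := fun n => by simp
  have h1 : ∀ α, ∑ᶠ n : ℕ+, omega1Term D a a' v α n = ∑ n ∈ Finset.range N,
      act (Tau.X B (-((n : ℤ) + 1)) (D.x (-α))) a
        (act (Tau.X B ((n : ℤ) + 1) (D.x α)) a' v) := fun α => by
    rw [finsum_pnat_eq_sum_range (N := N)]
    · simp only [omega1Term, hcast]
    · intro n hn
      rw [omega1Term, hcast, hN _ (by omega), map_zero]
  have h2 : ∀ i, ∑ᶠ n : ℕ+, omega2Term D a a' v i n = ∑ n ∈ Finset.range N,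
      act (Tau.X B (-((n : ℤ) + 1)) (D.h i : g)) a
        (act (Tau.X B ((n : ℤ) + 1) (D.h' i : g)) a' v) := fun i => by
    rw [finsum_pnat_eq_sum_range (N := N)]
    · simp only [omega2Term, hcast]
    · intro n hn
      rw [omega2Term, hcast, hN _ (by omega), map_zero]
  simp_rw [omega1, omega2, h1, h2, pairSum_fam_apply, Finset.sum_add_distrib]
  rw [Finset.sum_comm, Finset.sum_comm (s := Finset.univ)]

lemma omega_eq_omegaTrunc (a a' : A) (v : V) {N : ℕ}
    (hN : ∀ n : ℤ, N ≤ n → ∀ x : g, act (Tau.X B n x) a v = 0)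
    (hN' : ∀ n : ℤ, N ≤ n → ∀ x : g, act (Tau.X B n x) a' v = 0) :
    omega D a a' v = omegaTrunc D V a a' N v := by
  have h1 : AffCartan.toTau B H ((gamma B H).symm D.ρ) =
      Tau.X B 0 ((gamma B H).symm D.ρ).1 + (((gamma B H).symm D.ρ).2.1 • Tau.K B +
        ((gamma B H).symm D.ρ).2.2 • Tau.L B 0) := rfl
  have h2 := omega1_add_omega2 D a a' v hN'
  have h3 := omega1_add_omega2 D a' a v hN
  simp only [omegaTrunc, LinearMap.add_apply, LinearMap.sum_apply, Finset.sum_add_distrib, ← h2,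
    ← h3, pairSum_fam_zero, LinearMap.smul_apply, Module.End.mul_apply]
  rw [omega, h1, act_add, act_add, act_smul, act_smul]
  simp only [LinearMap.add_apply, LinearMap.smul_apply]
  module

lemma commute_act_K_omegaTrunc (a a' c : A) (N : ℕ) :
    Commute (act (Tau.K B) c) (omegaTrunc D V a a' N) := by
  have hK : ∀ (z : Tau B) (d : A), Commute (act (Tau.K B) c : Module.End ℂ V) (act z d) :=
    fun z d => by
      rw [Commute, SemiconjBy, act_mul_act, Tau.K_lie, act_zero, add_zero]
  have hS : ∀ (p q : ℤ) (d d' : A),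
      Commute (act (Tau.K B) c) (pairSum B V D.fam D.fam' p q d d') := fun p q d d' =>
    Commute.sum_right _ _ _ fun i _ => (hK _ _).mul_right (hK _ _)
  exact ((((((hS _ _ _ _).add_right ((hK _ _).smul_right _)).add_right
    ((hK _ _).smul_right _)).add_right ((hK _ _).mul_right (hK _ _))).add_right
    ((hK _ _).mul_right (hK _ _))).add_right
    (Commute.sum_right _ _ _ fun n _ => (hS _ _ _ _).add_right (hS _ _ _ _)))

/-- The central terms of the modes cancel against the commutators with `K d`, and the telescoping
remainder against the commutator with `2ρ(K) d(aa')`. The margin |m| in N makes the shifted tails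
vanish on v too. -/
lemma act_mul_omegaTrunc (hθ : IsHighestRoot b θ) (a a' : A) (v : V) (m : ℤ) (y : g) {N₀ N : ℕ}
    (h : ∀ n : ℤ, N₀ ≤ n → ∀ x : g, act (Tau.X B n x) a v = 0)
    (h' : ∀ n : ℤ, N₀ ≤ n → ∀ x : g, act (Tau.X B n x) a' v = 0) (hN : N₀ + |m| ≤ N) :
    act (Tau.X B m y) (1 : A) (omegaTrunc D V a a' N v) =
      omegaTrunc D V a a' N (act (Tau.X B m y) (1 : A) v) := by
  set Y : Module.End ℂ V := act (Tau.X B m y) (1 : A) with hY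
  set e := ((gamma B H).symm D.ρ).2.2
  set Z : Module.End ℂ V := act (Tau.K B) a * act (Tau.X B m y) a'
  set Z' : Module.End ℂ V := act (Tau.K B) a' * act (Tau.X B m y) a
  set P : ℤ → Module.End ℂ V := fun n => liePairSum B V D.fam D.fam' (m - n) n a a' y with hP
  set P' : ℤ → Module.End ℂ V := fun n => liePairSum B V D.fam D.fam' (m - n) n a' a y with hP'
  have hS : ∀ n, Y * pairSum B V D.fam D.fam' (-n) n a a' =
      pairSum B V D.fam D.fam' (-n) n a a' * Y + (P n - P (n + m)) +
        ((if m = n then (m : ℂ) • Z else 0) + if m = -n then (m : ℂ) • Z' else 0) :=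
    fun n => D.isDualFamily.act_mul_pairSum m n a a' y
  have hS' : ∀ n, Y * pairSum B V D.fam D.fam' (-n) n a' a =
      pairSum B V D.fam D.fam' (-n) n a' a * Y + (P' n - P' (n + m)) +
        ((if m = n then (m : ℂ) • Z' else 0) + if m = -n then (m : ℂ) • Z else 0) :=
    fun n => D.isDualFamily.act_mul_pairSum m n a' a y
  have hK : ∀ c : A, Y * act (Tau.K B) c = act (Tau.K B) c * Y := fun c => by
    rw [hY, act_mul_act, Tau.lie_K, act_zero, add_zero]
  have hL : ∀ c : A, Y * act (Tau.L B 0) c =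
      act (Tau.L B 0) c * Y - (m : ℂ) • act (Tau.X B m y) c := fun c => by
    rw [hY, act_mul_act, Tau.X_lie_L, act_neg, act_smul, one_mul, add_zero, ← sub_eq_add_neg]
  have hKL : ∀ c d : A, Y * (act (Tau.K B) c * act (Tau.L B 0) d) =
      act (Tau.K B) c * act (Tau.L B 0) d * Y -
        (m : ℂ) • (act (Tau.K B) c * act (Tau.X B m y) d) := fun c d => by
    rw [← mul_assoc, hK, mul_assoc, hL, mul_sub, mul_assoc, mul_smul_comm]
  have hsum : Y * ∑ n ∈ Finset.range N,
        (pairSum B V D.fam D.fam' (-((n : ℤ) + 1)) (n + 1) a a' +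
          pairSum B V D.fam D.fam' (-((n : ℤ) + 1)) (n + 1) a' a) =
      (∑ n ∈ Finset.range N,
        (pairSum B V D.fam D.fam' (-((n : ℤ) + 1)) (n + 1) a a' +
          pairSum B V D.fam D.fam' (-((n : ℤ) + 1)) (n + 1) a' a)) * Y +
      (∑ n ∈ Finset.range N, (P (n + 1) - P (n + 1 + m)) +
        ∑ n ∈ Finset.range N, (P' (n + 1) - P' (n + 1 + m))) + (m : ℂ) • (Z + Z') := by
    have hm : |m| ≤ N := by omega
    have hneg : ∀ n : ℕ, (m = -((n : ℤ) + 1)) = (-m = (n : ℤ) + 1) := fun n => by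
      rw [neg_eq_iff_eq_neg]
    rw [Finset.mul_sum, Finset.sum_mul]
    simp_rw [mul_add, hS, hS', add_mul, Finset.sum_add_distrib, hneg,
      sum_range_ite_eq_add_one m hm, sum_range_ite_eq_add_one (-m) (by rwa [abs_neg])]
    -- For m > 0 the central terms occur at mode n = m, for m < 0 at n = -m with Z and Z' exchanged;
    -- symmetrisation gives m(Z + Z') in either case.
    rcases lt_trichotomy m 0 with h0 | h0 | h0
    · rw [if_neg (by omega), if_pos (by omega), if_neg (by omega), if_pos (by omega)]
      rw [smul_add]
      abel
    · simp only [h0, Int.cast_zero, zero_smul, ite_self]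
      abel
    · rw [if_pos (by omega), if_neg (by omega), if_pos (by omega), if_neg (by omega)]
      rw [smul_add]
      abel
  have hS0 : Y * pairSum B V D.fam D.fam' 0 0 a a' =
      pairSum B V D.fam D.fam' 0 0 a a' * Y + (P 0 - P m) := by
    have h1 := hS 0
    -- In the zero modes a central term could occur only for m = 0, where its coefficient m
    -- vanishes.
    have h2 : ∀ z : Module.End ℂ V, (if m = 0 then (m : ℂ) • z else 0) = 0 := fun z => by
      split_ifs with hm
      · simp [hm]
      · rfl
    simp only [neg_zero, h2, add_zero, zero_add] at h1
    exact h1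
  have htele : ∑ n ∈ Finset.range N, (P (n + 1) v - P (n + 1 + m) v) +
      ∑ n ∈ Finset.range N, (P' (n + 1) v - P' (n + 1 + m) v) + (P 0 v - P m v) =
      m • act (Tau.X B m ((2 * e) • y)) (a * a') v := by
    refine sum_sub_shift_add (fun n => P n v) (fun n => P' n v) _ m N₀ (fun n hn => ?_)
      (fun n hn => ?_) (fun hm k => ?_) N hN
    · simp [hP, liePairSum, h' n hn]
    · simp [hP', liePairSum, h n hn]
    · have h1 := D.isDualFamily.liePairSum_swap (V := V) (p := k) (q := m - k) (by simpa using hm)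
        a a' y
      rw [D.casimir_eq hθ, add_sub_cancel] at h1
      have h2 := LinearMap.congr_fun h1 v
      rw [LinearMap.add_apply] at h2
      simpa only [hP, hP', sub_sub_cancel] using h2
  have hmain : Y * omegaTrunc D V a a' N = omegaTrunc D V a a' N * Y +
      (∑ n ∈ Finset.range N, (P (n + 1) - P (n + 1 + m)) +
        ∑ n ∈ Finset.range N, (P' (n + 1) - P' (n + 1 + m)) + (P 0 - P m)) -
      (2 * e * m) • act (Tau.X B m y) (a * a') := by
    simp only [omegaTrunc, mul_add, add_mul, hsum, hS0, hKL, mul_smul_comm, smul_mul_assoc, hK, hL]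
    module
  have h1 := LinearMap.congr_fun hmain v
  simp only [Module.End.mul_apply, LinearMap.add_apply, LinearMap.sub_apply, LinearMap.sum_apply,
    LinearMap.smul_apply] at h1
  rw [htele, map_smul, act_smul, LinearMap.smul_apply, ← Int.cast_smul_eq_zsmul ℂ, smul_smul,
    mul_comm (m : ℂ), add_sub_cancel_right] at h1
  exact h1

end Omega

/-! ### The affine subalgebra and its stability under ad L_j. -/

section Affine

variable {g : Type*} [LieRing g] [LieAlgebra ℂ g] {B : InvariantForm g}

lemma Tau.affine_induction {P : Tau B → Prop} (hadd : ∀ u v, P u → P v → P (u + v))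
    (hX : ∀ n x, P (Tau.X B n x)) (hK : ∀ c : ℂ, P (c • Tau.K B)) {u : Tau B}
    (hu : u ∈ Tau.affine B) : P u := by
  have key : ∀ f : ℤ →₀ g, P (LinearMap.inl ℂ (ℤ →₀ g) ((ℤ →₀ ℂ) × ℂ) f : Tau B) := fun f => by
    induction f using Finsupp.induction_linear with
    | zero =>
      have h0 := hX 0 0
      rw [map_zero] at h0
      rw [map_zero]
      exact h0
    | add f f' hf hf' =>
      rw [map_add]
      exact hadd _ _ hf hf'
    | single n x => exact hX n x
  let w : Tau B := LinearMap.inl ℂ (ℤ →₀ g) ((ℤ →₀ ℂ) × ℂ) u.1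
  have h1 : u = w + u.2.2 • Tau.K B := by
    refine Prod.ext ?_ (Prod.ext ?_ ?_)
    · exact (show u.1 = u.1 + u.2.2 • 0 by simp)
    · exact (show u.2.1 = 0 + u.2.2 • 0 by rw [show u.2.1 = 0 from hu]; simp)
    · exact (show u.2.2 = 0 + u.2.2 • 1 by simp)
  rw [h1]
  exact hadd _ _ (key u.1) (hK u.2.2)

lemma Tau.L_lie_mem_affine (j : ℤ) {u : Tau B} (hu : u ∈ Tau.affine B) :
    ⁅Tau.L B j, u⁆ ∈ Tau.affine B := by
  refine Tau.affine_induction (P := fun u => ⁅Tau.L B j, u⁆ ∈ Tau.affine B)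
    (fun u v hu hv => ?_) (fun n x => ?_) (fun c => ?_) hu
  · rw [lie_add]
    exact add_mem hu hv
  · rw [Tau.L_lie_X]
    exact (Tau.affine B).smul_mem _ rfl
  · rw [lie_smul, Tau.lie_K, smul_zero]
    exact zero_mem _

end Affine

/-! ### Centrality of Ω and of its commutators with L_j. -/

section Main

variable {g : Type*} [LieRing g] [LieAlgebra ℂ g] [FiniteDimensional ℂ g] [LieAlgebra.IsSimple ℂ g]
variable {B : InvariantForm g} {H : LieSubalgebra ℂ g} [H.IsCartanSubalgebra]
variable {b : (IsKilling.rootSystem H).Base} {θ : H.root} (D : CasimirData B b θ)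
variable {A : Type*} [CommRing A] [Algebra ℂ A]
variable {V : Type*} [AddCommGroup V] [Module ℂ V] [LieRingModule (A ⊗[ℂ] Tau B) V]
  [LieModule ℂ (A ⊗[ℂ] Tau B) V]

lemma CategoryO.locallyFinite (hV : CategoryO A B V b θ) (hθ : IsHighestRoot b θ) (a a' : A) :
    LocallyFinite D V a a' := by
  intro v
  obtain ⟨N, hN⟩ := hV.exists_act_X_eq_zero hθ v a'
  have hcast : ∀ n : ℕ, ((n.succPNat : ℕ+) : ℤ) = (n : ℤ) + 1 := fun n => by simp
  refine ⟨fun α _ => finite_ne_zero_of_succPNat (N := N) _ fun n hn => ?_,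
    fun i => finite_ne_zero_of_succPNat (N := N) _ fun n hn => ?_⟩
  · rw [omega1Term, hcast, hN _ (by omega), map_zero]
  · rw [omega2Term, hcast, hN _ (by omega), map_zero]

/-- The truncation level depends on v; allowing every larger level lets several vectors share one
linear operator. -/
lemma CategoryO.exists_omega_eq (hV : CategoryO A B V b θ) (hθ : IsHighestRoot b θ) (a a' : A)
    (v : V) : ∃ N₀ : ℕ, (∀ n : ℤ, N₀ ≤ n → ∀ x : g, act (Tau.X B n x) a v = 0) ∧
      (∀ n : ℤ, N₀ ≤ n → ∀ x : g, act (Tau.X B n x) a' v = 0) ∧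
      ∀ N : ℕ, N₀ ≤ N → omega D a a' v = omegaTrunc D V a a' N v := by
  obtain ⟨N, hN⟩ := hV.exists_act_X_eq_zero hθ v a
  obtain ⟨N', hN'⟩ := hV.exists_act_X_eq_zero hθ v a'
  exact ⟨max N N', fun n hn => hN n (by omega), fun n hn => hN' n (by omega), fun M hM =>
    omega_eq_omegaTrunc D a a' v (fun n hn => hN n (by omega)) fun n hn => hN' n (by omega)⟩

lemma CategoryO.isLinearMap_omega (hV : CategoryO A B V b θ) (hθ : IsHighestRoot b θ) (a a' : A) :
    IsLinearMap ℂ (omega D a a' : V → V) where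
  map_add v w := by
    obtain ⟨N₁, -, -, h₁⟩ := hV.exists_omega_eq D hθ a a' v
    obtain ⟨N₂, -, -, h₂⟩ := hV.exists_omega_eq D hθ a a' w
    obtain ⟨N₃, -, -, h₃⟩ := hV.exists_omega_eq D hθ a a' (v + w)
    rw [h₁ (N₁ + N₂ + N₃) (by omega), h₂ (N₁ + N₂ + N₃) (by omega),
      h₃ (N₁ + N₂ + N₃) (by omega), map_add]
  map_smul c v := by
    obtain ⟨N₁, -, -, h₁⟩ := hV.exists_omega_eq D hθ a a' v
    obtain ⟨N₂, -, -, h₂⟩ := hV.exists_omega_eq D hθ a a' (c • v)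
    rw [h₁ (N₁ + N₂) (by omega), h₂ (N₁ + N₂) (by omega), map_smul]

/-- `Ω(a,a')` commutes with the affine Lie algebra. -/
lemma CategoryO.isAffineCentral_omega (hV : CategoryO A B V b θ) (hθ : IsHighestRoot b θ)
    (a a' : A) : IsAffineCentral A B V (omega D a a') := by
  have hlin := hV.isLinearMap_omega D hθ a a'
  refine ⟨hlin, fun y hy => ?_⟩
  refine Tau.affine_induction (P := fun y => ∀ v : V,
    omega D a a' (act y (1 : A) v) = act y (1 : A) (omega D a a' v)) (fun u w hu hw v => ?_)
    (fun n x v => ?_) (fun c v => ?_) hy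
  · rw [act_add, LinearMap.add_apply, LinearMap.add_apply, hlin.map_add, hu, hw]
  · obtain ⟨N₁, h, h', h₁⟩ := hV.exists_omega_eq D hθ a a' v
    obtain ⟨N₂, -, -, h₂⟩ := hV.exists_omega_eq D hθ a a' (act (Tau.X B n x) (1 : A) v)
    have hn : (n.natAbs : ℤ) = |n| := Int.natCast_natAbs n
    rw [h₁ (N₁ + N₂ + n.natAbs) (by omega), h₂ (N₁ + N₂ + n.natAbs) (by omega)]
    exact (act_mul_omegaTrunc D hθ a a' v n x h h' (by push_cast; omega)).symm
  · obtain ⟨N₁, -, -, h₁⟩ := hV.exists_omega_eq D hθ a a' v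
    obtain ⟨N₂, -, -, h₂⟩ := hV.exists_omega_eq D hθ a a' (act (Tau.K B) (1 : A) v)
    rw [act_smul, LinearMap.smul_apply, LinearMap.smul_apply, hlin.map_smul,
      h₁ (N₁ + N₂) (by omega), h₂ (N₁ + N₂) (by omega)]
    exact congrArg (c • ·)
      (LinearMap.congr_fun (commute_act_K_omegaTrunc D a a' (1 : A) (N₁ + N₂)) v).symm

-- By Jacobi, the commutator of y with `[L_j, z]` involves only the commutators of z with y and with
-- `[L_j, y]`, both in the affine algebra.
omit [FiniteDimensional ℂ g] [LieAlgebra.IsSimple ℂ g] in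
lemma IsAffineCentral.lie_L {z : V → V} (hz : IsAffineCentral A B V z) (c : ℂ) (j : ℤ) :
    IsAffineCentral A B V fun v =>
      c • (act (Tau.L B j) (1 : A) (z v) - z (act (Tau.L B j) (1 : A) v)) := by
  refine ⟨⟨fun v w => ?_, fun r v => ?_⟩, fun y hy v => ?_⟩
  · simp only [map_add, hz.1.map_add]
    module
  · simp only [map_smul, hz.1.map_smul]
    module
  · have h1 := fun v : V => LinearMap.congr_fun
      (act_mul_act (V := V) (Tau.L B j) y (1 : A) 1) v
    simp only [Module.End.mul_apply, LinearMap.add_apply, mul_one] at h1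
    have h2 := hz.2 _ (Tau.L_lie_mem_affine j hy) v
    beta_reduce
    rw [hz.2 y hy, h1, h1, hz.1.map_add, hz.2 y hy, h2, map_smul, map_sub]
    module

end Main

end LoopAffineVirasoro

end

theorem theorem3p2 {g : Type*} [LieRing g] [LieAlgebra ℂ g] [FiniteDimensional ℂ g]
    [LieAlgebra.IsSimple ℂ g] (B : LoopAffineVirasoro.InvariantForm g)
    (H : LieSubalgebra ℂ g) [H.IsCartanSubalgebra]
    (b : (LieAlgebra.IsKilling.rootSystem H).Base) (θ : H.root)
    (hθ : LoopAffineVirasoro.IsHighestRoot b θ) (D : LoopAffineVirasoro.CasimirData B b θ)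
    {A : Type*} [CommRing A] [Algebra ℂ A] [Algebra.FiniteType ℂ A]
    {V : Type*} [AddCommGroup V] [Module ℂ V]
    [LieRingModule (A ⊗[ℂ] LoopAffineVirasoro.Tau B) V]
    [LieModule ℂ (A ⊗[ℂ] LoopAffineVirasoro.Tau B) V]
    (hV : LoopAffineVirasoro.CategoryO A B V b θ) (a a' : A) :
    LoopAffineVirasoro.LocallyFinite D V a a' ∧ LoopAffineVirasoro.LocallyFinite D V a' a ∧
      ∀ j : ℤ, LoopAffineVirasoro.IsAffineCentral A B V
        (fun v => LoopAffineVirasoro.T D j a a' v) := by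
  refine ⟨hV.locallyFinite D hθ a a', hV.locallyFinite D hθ a' a, fun j => ?_⟩
  have hΩ := hV.isAffineCentral_omega D hθ a a'
  by_cases hj : j = 0
  · simpa only [LoopAffineVirasoro.T, if_pos hj] using hΩ
  · simpa only [LoopAffineVirasoro.T, if_neg hj] using hΩ.lie_L (-1 / (j : ℂ)) j
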